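/- Let $T$ be a homeomorphism of a totally disconnected compact metric space $X$, let $K$ be a field, and let $C_K(X)$ be the ring of locally constant functions $X\to K$. Let $\mathcal A=C_K(X)\rtimes_T\mathbb Z$ be the algebraic crossed product, i.e. the ring of formal finite sums $\sum_{i\in\mathbb Z}a_it^i$ with $a_i\in C_K(X)$, with componentwise addition and multiplication determined by $ta=(a\circ T^{-1})\,t$. A *Sylvester matrix rank function* on a unital ring $R$ is a function $\mathrm{rk}$ assigning to each matrix over $R$ a nonnegative real number such that: (a) $\mathrm{rk}(M)=0$ for every zero matrix $M$, and $\mathrm{rk}(1)=1$; (b) $\mathrm{rk}(M_1M_2)\le \mathrm{rk}(M_1)$ and $\mathrm{rk}(M_1M_2)\le\mathrm{rk}(M_2)$ whenever the product is defined; (c) $\mathrm{rk}\begin{pmatrix}M_1&0\\0&M_2\end{pmatrix}=\mathrm{rk}(M_1)+\mathrm{rk}(M_2)$; (d) $\mathrm{rk}\begin{pmatrix}M_1&M_3\\0&M_2\end{pmatrix}\ge\mathrm{rk}(M_1)+\mathrm{rk}(M_2)$ for all matrices of appropriate sizes. Let $\mathbb P(R)$ be the set of all Sylvester matrix rank functions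 on $R$. A unital ring $S$ is *(von Neumann) regular* if every $x\in S$ satisfies $x=xyx$ for some $y\in S$. A *rank function* on $S$ is a function $N:S\to[0,1]$ with $N(1)=1$, $N(xy)\le N(x)$ and $N(xy)\le N(y)$ for all $x,y\in S$, $N(e+f)=N(e)+N(f)$ for orthogonal idempotents $e,f$, and $N(x)=0$ if and only if $x=0$. On a regular ring $S$, a rank function $N$ extends uniquely to a Sylvester matrix rank function $\mathrm{rk}_S$ on $S$; the pair $(S,\mathrm{rk}_S)$ is then called a *regular rank ring*. Let $\mathbb P_{\mathrm{reg}}(R)$ be the set of those $\mathrm{rk}\in\mathbb P(R)$ for which there are a regular rank ring $(S,\mathrm{rk}_S)$ and a unital ring homomorphism $\varphi:R\to S$ with $\mathrm{rk}(A)=\mathrm{rk}_S(\varphi(A))$ for every matrix $A$ over $R$. Then every Sylvester matrix rank function on $\mathcal A$ is regular in this sense: $$\mathbb P(\mathcal A)=\mathbb P_{\mathrm{reg}}(\mathcal A).$$ -/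

import Mathlib

universe u v

/-- A (von Neumann) regular ring: every `x` can be written `x = x y x`. -/
def IsVonNeumannRegular (R : Type u) [Ring R] : Prop :=
  ∀ x : R, ∃ y : R, x = x * y * x

/-- A rank function `N : R → [0,1]` on a unital ring `R`, i.e. a pseudo-rank function
vanishing only at `0`. -/
structure IsRankFunction {R : Type u} [Ring R] (N : R → ℝ) : Prop where
  mem_Icc : ∀ x, N x ∈ Set.Icc (0 : ℝ) 1
  map_one : N 1 = 1
  mul_le_left : ∀ x y, N (x * y) ≤ N x
  mul_le_right : ∀ x y, N (x * y) ≤ N y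
  add_of_orthogonal : ∀ e f : R, IsIdempotentElem e → IsIdempotentElem f →
    e * f = 0 → f * e = 0 → N (e + f) = N e + N f
  eq_zero_iff : ∀ x, N x = 0 ↔ x = 0

/-- Real-valued functions on the set of all (finite, rectangular) matrices over `R`. -/
abbrev MatrixFunction (R : Type u) : Type u :=
  ∀ m n : ℕ, Matrix (Fin m) (Fin n) R → ℝ

/-- The block matrix with rows `(M₁ M₃)` and `(0 M₂)`, with rows and columns numbered
consecutively. -/
def blockUpper {R : Type u} [Ring R] {m₁ n₁ m₂ n₂ : ℕ} (M₁ : Matrix (Fin m₁) (Fin n₁) R)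
    (M₂ : Matrix (Fin m₂) (Fin n₂) R) (M₃ : Matrix (Fin m₁) (Fin n₂) R) :
    Matrix (Fin (m₁ + m₂)) (Fin (n₁ + n₂)) R :=
  (Matrix.fromBlocks M₁ M₃ 0 M₂).reindex finSumFinEquiv finSumFinEquiv

/-- Sylvester matrix rank functions on a unital ring `R`. Empty matrices are allowed; being zero
matrices they have rank `0`. -/
structure IsSylvesterRank {R : Type u} [Ring R] (rk : MatrixFunction R) : Prop where
  nonneg : ∀ (m n : ℕ) (M : Matrix (Fin m) (Fin n) R), 0 ≤ rk m n M
  map_zero : ∀ m n : ℕ, rk m n 0 = 0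
  map_one : rk 1 1 1 = 1
  mul_le_left : ∀ (l m n : ℕ) (M₁ : Matrix (Fin l) (Fin m) R) (M₂ : Matrix (Fin m) (Fin n) R),
    rk l n (M₁ * M₂) ≤ rk l m M₁
  mul_le_right : ∀ (l m n : ℕ) (M₁ : Matrix (Fin l) (Fin m) R) (M₂ : Matrix (Fin m) (Fin n) R),
    rk l n (M₁ * M₂) ≤ rk m n M₂
  diag_eq : ∀ (m₁ n₁ m₂ n₂ : ℕ) (M₁ : Matrix (Fin m₁) (Fin n₁) R)
    (M₂ : Matrix (Fin m₂) (Fin n₂) R),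
    rk _ _ (blockUpper M₁ M₂ 0) = rk _ _ M₁ + rk _ _ M₂
  le_upper : ∀ (m₁ n₁ m₂ n₂ : ℕ) (M₁ : Matrix (Fin m₁) (Fin n₁) R)
    (M₂ : Matrix (Fin m₂) (Fin n₂) R) (M₃ : Matrix (Fin m₁) (Fin n₂) R),
    rk _ _ M₁ + rk _ _ M₂ ≤ rk _ _ (blockUpper M₁ M₂ M₃)

/-- `ℙ(R)`: the set of Sylvester matrix rank functions on `R`. -/
def SylvesterSpace (R : Type u) [Ring R] : Set (MatrixFunction R) :=
  {rk | IsSylvesterRank rk}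

/-- `ℙ_reg(R)`: the Sylvester matrix rank functions on `R` induced by a unital homomorphism `φ`
to a regular rank ring `(S, N)`. The rank of a matrix over `S` is given by the Sylvester
matrix rank function `rkS` extending `N` (which is unique, as `S` is regular).

Letting `S` range over the universe of `R` is no restriction: the image of `φ` is contained in a
regular subring of `S` of cardinality at most `max |R| ℵ₀`, obtained by adjoining quasi-inverses
repeatedly. -/
def RegularSylvesterSpace (R : Type u) [Ring R] : Set (MatrixFunction R) :=
  {rk | IsSylvesterRank rk ∧
    ∃ (S : Type u) (_ : Ring S) (N : S → ℝ) (rkS : MatrixFunction S) (φ : R →+* S),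
      IsVonNeumannRegular S ∧ IsRankFunction N ∧
      IsSylvesterRank rkS ∧ (∀ x : S, rkS 1 1 (Matrix.of fun _ _ => x) = N x) ∧
      ∀ (m n : ℕ) (A : Matrix (Fin m) (Fin n) R), rk m n A = rkS m n (A.map φ)}

/-- The action of `ℤ` on a ring `A` by the powers of an automorphism `α`. -/
@[reducible]
def zpowAction {A : Type u} [Ring A] (α : RingAut A) :
    MulSemiringAction (Multiplicative ℤ) A :=
  MulSemiringAction.compHom A (zpowersHom (RingAut A) α)

/-- The algebraic crossed product `A ⋊_α ℤ`: finite formal sums `∑ aᵢ tⁱ` with `aᵢ ∈ A`, added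
componentwise and multiplied by the rule `t a = α(a) t`. -/
def CrossedProduct {A : Type u} [Ring A] (_α : RingAut A) : Type u :=
  SkewMonoidAlgebra A (Multiplicative ℤ)

noncomputable instance {A : Type u} [Ring A] (α : RingAut A) : Ring (CrossedProduct α) :=
  letI := zpowAction α
  inferInstanceAs (Ring (SkewMonoidAlgebra A (Multiplicative ℤ)))

/-- The automorphism `b ↦ b ∘ T⁻¹` of the ring `C_K(X)` of locally constant functions `X → K`. -/
def homeoAut {X : Type u} [TopologicalSpace X] (K : Type v) [Field K] (T : X ≃ₜ X) :
    RingAut (LocallyConstant X K) :=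
  LocallyConstant.congrLeftRingEquiv T

/-- `C_K(X) ⋊_T ℤ`. -/
abbrev HomeoCrossedProduct {X : Type u} [TopologicalSpace X] (K : Type v) [Field K]
    (T : X ≃ₜ X) : Type (max u v) :=
  CrossedProduct (homeoAut K T)

/-!
A Sylvester rank function on the crossed product restricts, on characteristic functions of clopen
sets, to a `T`-invariant content `μ` on `X`. A Rokhlin-type argument (`exists_towers`) gives a
partition of `X` into finitely many clopen towers, fine enough for any given finite set of locally
constant functions, such that a point on the top level of a tower returns to the base of the same
tower, unless it lies in an exceptional set of small content. Indeed the base of a tall tower has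
small content; and a base point of a short tower that returns to another tower is near the points
of some small period but does not have this period itself, and the content of such points is made
small by outer regularity of `μ`. No freeness is needed: periodic points may have positive measure.

Replace `t` by the element that moves up along each tower and returns to its base by the
compression `g = e tʰ⁺¹ e` to the projection `e` on the base, which ignores returns to other towers.
The levels form matrix units, and so this element and the given functions lie in the image of a
finite product `∏ᵢ M_{hᵢ+1}(K[X])`, where the variable acts as `g`; and it differs from `t` by an
element of small rank (`Implements.exists_approx`).

On such a product, every rank function agrees, on a given finite set of matrices, with a nonnegative
combination of ranks of finite-dimensional representations. By Morita invariance and additivity this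
is a question about `K[X]` (`isLocallyRepresentable_polynomial`), by the Smith normal form one about
single polynomials, and by additivity over coprime factors one about powers `pᵏ` of a prime: the
corank of `pᵏ` is concave in `k`, and its negated second differences are the weights of the
representations on `K[X] ⧸ (pʲ)` (`exists_repCone_elt_eq`). A combination of ranks of
finite-dimensional representations comes from a finite product of matrix rings over `K`, which is a
regular ring.

So the rank function, pulled back to the ring of noncommutative polynomials in `t` and the locally
constant functions, is a limit of rank functions induced from regular rings. Noncommutative
polynomials are needed because `t` and its approximation satisfy different relations. An
ultraproduct modulo its elements of rank `0` is then a regular rank ring inducing the pulled back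
function (`exists_regularRankRing_of_approx`). As only `0` has rank `0` there, the homomorphism
respects all relations of the crossed product; the image of `t` has rank `1`, hence is invertible;
and so the homomorphism descends to the crossed product
(`exists_regularRankRing_of_isSylvesterRank`).
-/

universe w a b

/-! ### Rank functions without normalization -/

/-- The axioms of a Sylvester matrix rank function, except that the rank of `1` is arbitrary. Unlike
Sylvester rank functions, these form a cone and can be pulled back along non-unital homomorphisms,
for instance to a corner of a ring. -/
structure IsWeakSylvester {R : Type u} [Ring R] (rk : MatrixFunction R) : Prop where
  nonneg : ∀ (m n : ℕ) (M : Matrix (Fin m) (Fin n) R), 0 ≤ rk m n M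
  map_zero : ∀ m n : ℕ, rk m n 0 = 0
  mul_le_left : ∀ (l m n : ℕ) (M₁ : Matrix (Fin l) (Fin m) R) (M₂ : Matrix (Fin m) (Fin n) R),
    rk l n (M₁ * M₂) ≤ rk l m M₁
  mul_le_right : ∀ (l m n : ℕ) (M₁ : Matrix (Fin l) (Fin m) R) (M₂ : Matrix (Fin m) (Fin n) R),
    rk l n (M₁ * M₂) ≤ rk m n M₂
  diag_eq : ∀ (m₁ n₁ m₂ n₂ : ℕ) (M₁ : Matrix (Fin m₁) (Fin n₁) R)
    (M₂ : Matrix (Fin m₂) (Fin n₂) R),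
    rk _ _ (blockUpper M₁ M₂ 0) = rk _ _ M₁ + rk _ _ M₂
  le_upper : ∀ (m₁ n₁ m₂ n₂ : ℕ) (M₁ : Matrix (Fin m₁) (Fin n₁) R)
    (M₂ : Matrix (Fin m₂) (Fin n₂) R) (M₃ : Matrix (Fin m₁) (Fin n₂) R),
    rk _ _ M₁ + rk _ _ M₂ ≤ rk _ _ (blockUpper M₁ M₂ M₃)

theorem IsSylvesterRank.isWeakSylvester {R : Type u} [Ring R] {rk : MatrixFunction R}
    (h : IsSylvesterRank rk) : IsWeakSylvester rk :=
  ⟨h.nonneg, h.map_zero, h.mul_le_left, h.mul_le_right, h.diag_eq, h.le_upper⟩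

namespace MatrixFunction

/-- The value of a matrix function on a matrix indexed by arbitrary finite types, through
enumerations of the index types. -/
noncomputable def onFintype {R : Type u} (rk : MatrixFunction R) {m n : Type*} [Fintype m]
    [Fintype n] (M : Matrix m n R) : ℝ :=
  rk _ _ (M.submatrix (Fintype.equivFin m).symm (Fintype.equivFin n).symm)

/-- The value of a matrix function on an element of the ring, seen as a `1 × 1` matrix. -/
def elt {R : Type u} (rk : MatrixFunction R) (x : R) : ℝ :=
  rk 1 1 (Matrix.of fun _ _ => x)

end MatrixFunction

namespace IsWeakSylvester

open Matrix

variable {R : Type u} [Ring R] {rk : MatrixFunction R}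

/-- Passing to a submatrix, possibly with repeated rows and columns, is multiplication by
matrices on both sides. So the enumerations used in `MatrixFunction.onFintype` do not matter. -/
theorem submatrix_le_fin (h : IsWeakSylvester rk) {a b a' b' : ℕ} (M : Matrix (Fin a') (Fin b') R)
    (e : Fin a → Fin a') (f : Fin b → Fin b') : rk _ _ (M.submatrix e f) ≤ rk _ _ M := by
  have : M.submatrix e f =
      (1 : Matrix (Fin a') (Fin a') R).submatrix e id *
        (M * (1 : Matrix (Fin b') (Fin b') R).submatrix id f) := by
    ext i j
    simp [Matrix.mul_apply, Matrix.one_apply]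
  rw [this]
  exact (h.mul_le_right _ _ _ _ _).trans (h.mul_le_left _ _ _ _ _)

section

variable {l m n p q : Type*} [Fintype l] [Fintype m] [Fintype n] [Fintype p] [Fintype q]

theorem submatrix_le (h : IsWeakSylvester rk) (M : Matrix m n R) (e : p → m) (f : q → n) :
    rk.onFintype (M.submatrix e f) ≤ rk.onFintype M := by
  have := h.submatrix_le_fin (M.submatrix (Fintype.equivFin m).symm (Fintype.equivFin n).symm)
    (Fintype.equivFin m ∘ e ∘ (Fintype.equivFin p).symm)
    (Fintype.equivFin n ∘ f ∘ (Fintype.equivFin q).symm)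
  simpa [MatrixFunction.onFintype, Matrix.submatrix_submatrix, Function.comp_def] using this

theorem onFintype_eq (h : IsWeakSylvester rk) {a b : ℕ} (M : Matrix m n R) (e : Fin a ≃ m)
    (f : Fin b ≃ n) : rk a b (M.submatrix e f) = rk.onFintype M := by
  refine le_antisymm ?_ ?_
  · have := h.submatrix_le_fin
      (M.submatrix (Fintype.equivFin m).symm (Fintype.equivFin n).symm)
      (Fintype.equivFin m ∘ e) (Fintype.equivFin n ∘ f)
    simpa [MatrixFunction.onFintype, Matrix.submatrix_submatrix, Function.comp_def] using this
  · have := h.submatrix_le_fin (M.submatrix e f)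
      (e.symm ∘ (Fintype.equivFin m).symm) (f.symm ∘ (Fintype.equivFin n).symm)
    simpa [MatrixFunction.onFintype, Matrix.submatrix_submatrix, Function.comp_def] using this

theorem onFintype_fin (h : IsWeakSylvester rk) {a b : ℕ} (M : Matrix (Fin a) (Fin b) R) :
    rk.onFintype M = rk a b M :=
  (h.onFintype_eq M (Equiv.refl _) (Equiv.refl _)).symm

theorem onFintype_submatrix (h : IsWeakSylvester rk) (M : Matrix m n R) (e : p ≃ m) (f : q ≃ n) :
    rk.onFintype (M.submatrix e f) = rk.onFintype M := by
  refine le_antisymm (h.submatrix_le _ _ _) ?_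
  simpa [Matrix.submatrix_submatrix] using h.submatrix_le (M.submatrix e f) e.symm f.symm

theorem onFintype_zero (h : IsWeakSylvester rk) : rk.onFintype (0 : Matrix m n R) = 0 :=
  h.map_zero _ _

theorem onFintype_mul_le_left (h : IsWeakSylvester rk) (M : Matrix l m R) (N : Matrix m n R) :
    rk.onFintype (M * N) ≤ rk.onFintype M := by
  unfold MatrixFunction.onFintype
  rw [← Matrix.submatrix_mul_equiv M N _ (Fintype.equivFin m).symm]
  exact h.mul_le_left _ _ _ _ _

theorem onFintype_mul_le_right (h : IsWeakSylvester rk) (M : Matrix l m R) (N : Matrix m n R) :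
    rk.onFintype (M * N) ≤ rk.onFintype N := by
  unfold MatrixFunction.onFintype
  rw [← Matrix.submatrix_mul_equiv M N _ (Fintype.equivFin m).symm]
  exact h.mul_le_right _ _ _ _ _

theorem onFintype_fromBlocks_le (h : IsWeakSylvester rk) (A : Matrix l m R) (B : Matrix p q R)
    (C : Matrix l q R) :
    rk.onFintype A + rk.onFintype B ≤ rk.onFintype (fromBlocks A C 0 B) := by
  refine (h.le_upper _ _ _ _ (A.submatrix (Fintype.equivFin l).symm (Fintype.equivFin m).symm)
    (B.submatrix (Fintype.equivFin p).symm (Fintype.equivFin q).symm)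
    (C.submatrix (Fintype.equivFin l).symm (Fintype.equivFin q).symm)).trans_eq ?_
  rw [← h.onFintype_eq (fromBlocks A C 0 B)
    (finSumFinEquiv.symm.trans ((Fintype.equivFin l).symm.sumCongr (Fintype.equivFin p).symm))
    (finSumFinEquiv.symm.trans ((Fintype.equivFin m).symm.sumCongr (Fintype.equivFin q).symm))]
  congr 1
  rw [Equiv.coe_trans, Equiv.coe_trans, ← Matrix.submatrix_submatrix]
  simp only [blockUpper, Matrix.reindex_apply]
  congr 1
  ext (i | i) (j | j) <;> rfl

theorem onFintype_fromBlocks_diag (h : IsWeakSylvester rk) (A : Matrix l m R) (B : Matrix p q R) :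
    rk.onFintype (fromBlocks A 0 0 B) = rk.onFintype A + rk.onFintype B := by
  refine Eq.trans ?_ (h.diag_eq _ _ _ _
    (A.submatrix (Fintype.equivFin l).symm (Fintype.equivFin m).symm)
    (B.submatrix (Fintype.equivFin p).symm (Fintype.equivFin q).symm))
  rw [← h.onFintype_eq (fromBlocks A 0 0 B)
    (finSumFinEquiv.symm.trans ((Fintype.equivFin l).symm.sumCongr (Fintype.equivFin p).symm))
    (finSumFinEquiv.symm.trans ((Fintype.equivFin m).symm.sumCongr (Fintype.equivFin q).symm))]
  congr 1
  rw [Equiv.coe_trans, Equiv.coe_trans, ← Matrix.submatrix_submatrix]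
  simp only [blockUpper, Matrix.reindex_apply]
  congr 1
  ext (i | i) (j | j) <;> rfl

theorem onFintype_add_le (h : IsWeakSylvester rk) (A B : Matrix m n R) :
    rk.onFintype (A + B) ≤ rk.onFintype A + rk.onFintype B := by
  classical
  have : A + B = (fromCols 1 1 : Matrix m (m ⊕ m) R) *
      (fromBlocks A 0 0 B * (fromRows 1 1 : Matrix (n ⊕ n) n R)) := by
    rw [fromBlocks_mul_fromRows, fromCols_mul_fromRows]
    simp
  rw [this, ← h.onFintype_fromBlocks_diag]
  exact (h.onFintype_mul_le_right _ _).trans (h.onFintype_mul_le_left _ _)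

theorem onFintype_neg (h : IsWeakSylvester rk) (A : Matrix m n R) :
    rk.onFintype (-A) = rk.onFintype A := by
  classical
  have key : ∀ A : Matrix m n R, rk.onFintype (-A) ≤ rk.onFintype A := fun A => by
    have : -A = (-1 : Matrix m m R) * A := by simp
    rw [this]
    exact h.onFintype_mul_le_right _ _
  exact le_antisymm (key A) (by simpa using key (-A))

theorem onFintype_le_add_sub (h : IsWeakSylvester rk) (A B : Matrix m n R) :
    rk.onFintype A ≤ rk.onFintype B + rk.onFintype (A - B) := by
  simpa using h.onFintype_add_le B (A - B)

theorem abs_onFintype_sub_le (h : IsWeakSylvester rk) (A B : Matrix m n R) :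
    |rk.onFintype A - rk.onFintype B| ≤ rk.onFintype (A - B) := by
  have h1 := h.onFintype_le_add_sub A B
  have h2 := h.onFintype_le_add_sub B A
  rw [← neg_sub A B, h.onFintype_neg] at h2
  rw [abs_le]
  constructor <;> linarith

theorem onFintype_sum_le (h : IsWeakSylvester rk) {ι : Type*} (s : Finset ι)
    (A : ι → Matrix m n R) :
    rk.onFintype (∑ i ∈ s, A i) ≤ ∑ i ∈ s, rk.onFintype (A i) := by
  classical
  induction s using Finset.induction_on with
  | empty => simp [h.onFintype_zero]
  | insert a s ha ih =>
    rw [Finset.sum_insert ha, Finset.sum_insert ha]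
    exact (h.onFintype_add_le _ _).trans (by linarith)

/-- The rank is additive on `A + B` when `A` and `B` are separated by multipliers on both sides:
then `A + B` and the block diagonal matrix of `A` and `B` are factors of one another. -/
theorem onFintype_add_of_separated (h : IsWeakSylvester rk) (A B : Matrix m n R)
    (P P' : Matrix m m R) (Q Q' : Matrix n n R) (hPA : P * A = A) (hPB : P * B = 0)
    (hPA' : P' * A = 0) (hPB' : P' * B = B) (hQA : A * Q = A) (hQB : B * Q = 0)
    (hQA' : A * Q' = 0) (hQB' : B * Q' = B) :
    rk.onFintype (A + B) = rk.onFintype A + rk.onFintype B := by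
  refine le_antisymm (h.onFintype_add_le _ _) ?_
  rw [← h.onFintype_fromBlocks_diag]
  have : fromBlocks A 0 0 B = fromRows P P' * ((A + B) * fromCols Q Q') := by
    rw [mul_fromCols, fromRows_mul_fromCols]
    simp only [Matrix.add_mul, hPA, hPB, hPA', hPB', hQA, hQB,
      hQA', hQB', add_zero, zero_add]
  rw [this]
  exact (h.onFintype_mul_le_right _ _).trans (h.onFintype_mul_le_left _ _)

theorem elt_eq (h : IsWeakSylvester rk) (x : R) [Unique m] [Unique n] :
    rk.onFintype (Matrix.of fun (_ : m) (_ : n) => x) = rk.elt x :=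
  (h.onFintype_eq (Matrix.of fun (_ : m) (_ : n) => x) (Equiv.ofUnique (Fin 1) m)
    (Equiv.ofUnique (Fin 1) n)).symm

/-- A matrix has small rank if all its entries have: with `abs_onFintype_sub_le`, this makes the
rank of a matrix a Lipschitz function of its entries. -/
theorem onFintype_le_sum_elt (h : IsWeakSylvester rk) (M : Matrix m n R) :
    rk.onFintype M ≤ ∑ i, ∑ j, rk.elt (M i j) := by
  classical
  conv_lhs => rw [matrix_eq_sum_single M]
  refine (h.onFintype_sum_le _ _).trans (Finset.sum_le_sum fun i _ => ?_)
  refine (h.onFintype_sum_le _ _).trans (Finset.sum_le_sum fun j _ => ?_)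
  have : Matrix.single i j (M i j) = (Matrix.of fun a (_ : Unit) => if a = i then (1 : R) else 0) *
      ((Matrix.of fun (_ : Unit) (_ : Unit) => M i j) *
        (Matrix.of fun (_ : Unit) b => if b = j then (1 : R) else 0)) := by
    ext a b
    simp only [Matrix.single_apply, Matrix.mul_apply, Finset.univ_unique, Finset.sum_singleton,
      Matrix.of_apply]
    by_cases hi : i = a <;> by_cases hj : j = b <;> simp [hi, hj, eq_comm]
  rw [this]
  exact (h.onFintype_mul_le_right _ _).trans ((h.onFintype_mul_le_left _ _).trans_eq (h.elt_eq _))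

end

theorem of_const_mul_of_const (x y : R) :
    (Matrix.of fun (_ _ : Fin 1) => x) * (Matrix.of fun (_ _ : Fin 1) => y) =
      Matrix.of fun _ _ => x * y := by
  ext
  simp [Matrix.mul_apply]

theorem elt_nonneg (h : IsWeakSylvester rk) (x : R) : 0 ≤ rk.elt x := h.nonneg _ _ _

theorem elt_zero (h : IsWeakSylvester rk) : rk.elt (0 : R) = 0 := h.map_zero 1 1

theorem elt_mul_le_left (h : IsWeakSylvester rk) (x y : R) : rk.elt (x * y) ≤ rk.elt x := by
  have := h.mul_le_left 1 1 1 (Matrix.of fun _ _ => x) (Matrix.of fun _ _ => y)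
  rwa [of_const_mul_of_const] at this

theorem elt_mul_le_right (h : IsWeakSylvester rk) (x y : R) : rk.elt (x * y) ≤ rk.elt y := by
  have := h.mul_le_right 1 1 1 (Matrix.of fun _ _ => x) (Matrix.of fun _ _ => y)
  rwa [of_const_mul_of_const] at this

theorem elt_add_le (h : IsWeakSylvester rk) (x y : R) : rk.elt (x + y) ≤ rk.elt x + rk.elt y := by
  simp only [← h.elt_eq (m := Fin 1) (n := Fin 1)]
  exact h.onFintype_add_le _ _

theorem elt_neg (h : IsWeakSylvester rk) (x : R) : rk.elt (-x) = rk.elt x := by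
  simp only [← h.elt_eq (m := Fin 1) (n := Fin 1)]
  exact h.onFintype_neg _

theorem elt_le_one (h : IsWeakSylvester rk) (x : R) : rk.elt x ≤ rk.elt 1 := by
  simpa using h.elt_mul_le_right x 1

theorem elt_sum_le (h : IsWeakSylvester rk) {ι : Type*} (s : Finset ι) (x : ι → R) :
    rk.elt (∑ i ∈ s, x i) ≤ ∑ i ∈ s, rk.elt (x i) := by
  classical
  induction s using Finset.induction_on with
  | empty => simp [h.elt_zero]
  | insert a s ha ih =>
    rw [Finset.sum_insert ha, Finset.sum_insert ha]
    exact (h.elt_add_le _ _).trans (by linarith)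

theorem elt_add_of_orthogonal (h : IsWeakSylvester rk) {e f : R} (he : IsIdempotentElem e)
    (hf : IsIdempotentElem f) (hef : e * f = 0) (hfe : f * e = 0) :
    rk.elt (e + f) = rk.elt e + rk.elt f := by
  have k0 : (Matrix.of fun (_ _ : Fin 1) => (0 : R)) = 0 := rfl
  have := h.onFintype_add_of_separated (Matrix.of fun (_ _ : Fin 1) => e)
    (Matrix.of fun (_ _ : Fin 1) => f) (Matrix.of fun (_ _ : Fin 1) => e)
    (Matrix.of fun (_ _ : Fin 1) => f) (Matrix.of fun (_ _ : Fin 1) => e)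
    (Matrix.of fun (_ _ : Fin 1) => f)
    (by rw [of_const_mul_of_const, he.eq]) (by rw [of_const_mul_of_const, hef, k0])
    (by rw [of_const_mul_of_const, hfe, k0]) (by rw [of_const_mul_of_const, hf.eq])
    (by rw [of_const_mul_of_const, he.eq]) (by rw [of_const_mul_of_const, hfe, k0])
    (by rw [of_const_mul_of_const, hef, k0]) (by rw [of_const_mul_of_const, hf.eq])
  rw [← h.elt_eq (m := Fin 1) (n := Fin 1), ← h.elt_eq (m := Fin 1) (n := Fin 1) e,
    ← h.elt_eq (m := Fin 1) (n := Fin 1) f, ← this]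
  rfl

theorem le_mul_elt_one (h : IsWeakSylvester rk) {m n : ℕ} (M : Matrix (Fin m) (Fin n) R) :
    rk m n M ≤ m * n * rk.elt 1 := by
  rw [← h.onFintype_fin]
  refine (h.onFintype_le_sum_elt M).trans ?_
  calc ∑ i, ∑ j, rk.elt (M i j) ≤ ∑ _i : Fin m, ∑ _j : Fin n, rk.elt 1 :=
        Finset.sum_le_sum fun i _ => Finset.sum_le_sum fun j _ => h.elt_le_one _
    _ = m * n * rk.elt 1 := by simp [mul_assoc]

section pullback

variable {R' : Type w} [Ring R'] {F : Type*} [FunLike F R' R] [NonUnitalRingHomClass F R' R]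

theorem _root_.blockUpper_map (f : F) {m₁ n₁ m₂ n₂ : ℕ}
    (M₁ : Matrix (Fin m₁) (Fin n₁) R') (M₂ : Matrix (Fin m₂) (Fin n₂) R')
    (M₃ : Matrix (Fin m₁) (Fin n₂) R') :
    (blockUpper M₁ M₂ M₃).map f = blockUpper (M₁.map f) (M₂.map f) (M₃.map f) := by
  simp only [blockUpper, Matrix.reindex_apply, ← Matrix.submatrix_map, Matrix.fromBlocks_map]
  rw [Matrix.map_zero _ (_root_.map_zero f)]

/-- Weak Sylvester functions pull back along ring homomorphisms, unital or not. -/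
theorem comap (h : IsWeakSylvester rk) (f : F) :
    IsWeakSylvester (fun m n (M : Matrix (Fin m) (Fin n) R') => rk m n (M.map f)) where
  nonneg m n M := h.nonneg _ _ _
  map_zero m n := by
    rw [Matrix.map_zero _ (_root_.map_zero f)]
    exact h.map_zero _ _
  mul_le_left l m n M N := by
    rw [Matrix.map_mul]
    exact h.mul_le_left _ _ _ _ _
  mul_le_right l m n M N := by
    rw [Matrix.map_mul]
    exact h.mul_le_right _ _ _ _ _
  diag_eq m₁ n₁ m₂ n₂ M N := by
    rw [blockUpper_map, Matrix.map_zero _ (_root_.map_zero f)]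
    exact h.diag_eq _ _ _ _ _ _
  le_upper m₁ n₁ m₂ n₂ M N P := by
    rw [blockUpper_map]
    exact h.le_upper _ _ _ _ _ _ _

end pullback

theorem zero : IsWeakSylvester (fun _ _ _ => 0 : MatrixFunction R) where
  nonneg _ _ _ := le_rfl
  map_zero _ _ := rfl
  mul_le_left _ _ _ _ _ := le_rfl
  mul_le_right _ _ _ _ _ := le_rfl
  diag_eq _ _ _ _ _ _ := (add_zero _).symm
  le_upper _ _ _ _ _ _ _ := (add_zero _).le

theorem add {rk' : MatrixFunction R} (h : IsWeakSylvester rk) (h' : IsWeakSylvester rk') :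
    IsWeakSylvester (fun m n M => rk m n M + rk' m n M) where
  nonneg _ _ _ := add_nonneg (h.nonneg _ _ _) (h'.nonneg _ _ _)
  map_zero _ _ := by rw [h.map_zero, h'.map_zero, add_zero]
  mul_le_left _ _ _ _ _ := add_le_add (h.mul_le_left _ _ _ _ _) (h'.mul_le_left _ _ _ _ _)
  mul_le_right _ _ _ _ _ := add_le_add (h.mul_le_right _ _ _ _ _) (h'.mul_le_right _ _ _ _ _)
  diag_eq _ _ _ _ _ _ := by rw [h.diag_eq, h'.diag_eq]; ring
  le_upper _ _ _ _ M₁ M₂ M₃ := by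
    linarith [h.le_upper _ _ _ _ M₁ M₂ M₃, h'.le_upper _ _ _ _ M₁ M₂ M₃]

theorem smul (h : IsWeakSylvester rk) {c : ℝ} (hc : 0 ≤ c) :
    IsWeakSylvester (fun m n M => c * rk m n M) where
  nonneg _ _ _ := mul_nonneg hc (h.nonneg _ _ _)
  map_zero _ _ := by rw [h.map_zero, mul_zero]
  mul_le_left _ _ _ _ _ := mul_le_mul_of_nonneg_left (h.mul_le_left _ _ _ _ _) hc
  mul_le_right _ _ _ _ _ := mul_le_mul_of_nonneg_left (h.mul_le_right _ _ _ _ _) hc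
  diag_eq _ _ _ _ _ _ := by rw [h.diag_eq, mul_add]
  le_upper _ _ _ _ M₁ M₂ M₃ := by
    rw [← mul_add]
    exact mul_le_mul_of_nonneg_left (h.le_upper _ _ _ _ M₁ M₂ M₃) hc

end IsWeakSylvester

/-! ### Regular rank rings from approximations -/

section ultralimits

open Filter Topology

section quotient

variable {R : Type u} [Ring R] {rk : MatrixFunction R}

/-- The congruence identifying two elements whose difference has rank `0`. -/
def IsWeakSylvester.nullCon (h : IsWeakSylvester rk) : RingCon R where
  r x y := rk.elt (x - y) = 0
  iseqv :=
    { refl := fun x => by rw [sub_self, h.elt_zero]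
      symm := fun {x y} hxy => by rw [← neg_sub, h.elt_neg, hxy]
      trans := fun {x y z} hxy hyz => by
        refine le_antisymm ?_ (h.elt_nonneg _)
        rw [← sub_add_sub_cancel x y z]
        exact (h.elt_add_le _ _).trans (by rw [hxy, hyz, add_zero]) }
  add' := fun {x y z t} hxy hzt => by
    refine le_antisymm ?_ (h.elt_nonneg _)
    rw [add_sub_add_comm]
    exact (h.elt_add_le _ _).trans (by rw [hxy, hzt, add_zero])
  mul' := fun {x y z t} hxy hzt => by
    refine le_antisymm ?_ (h.elt_nonneg _)
    have : x * z - y * t = (x - y) * z + y * (z - t) := by noncomm_ring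
    rw [this]
    refine (h.elt_add_le _ _).trans ?_
    exact (add_le_add (h.elt_mul_le_left _ _) (h.elt_mul_le_right _ _)).trans
      (by rw [hxy, hzt, add_zero])

theorem IsVonNeumannRegular.of_surjective {S : Type w} [Ring S] (hR : IsVonNeumannRegular R)
    (f : R →+* S) (hf : Function.Surjective f) : IsVonNeumannRegular S := by
  intro y
  obtain ⟨x, rfl⟩ := hf y
  obtain ⟨z, hz⟩ := hR x
  exact ⟨f z, by rw [← map_mul, ← map_mul, ← hz]⟩

/-- Dividing a regular ring by the elements of rank `0` yields a regular rank ring. -/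
theorem IsWeakSylvester.exists_regularRankRing (h : IsWeakSylvester rk) (h1 : rk.elt 1 = 1)
    (hR : IsVonNeumannRegular R) :
    ∃ (S : Type u) (_ : Ring S) (N : S → ℝ) (rkS : MatrixFunction S) (φ : R →+* S),
      IsVonNeumannRegular S ∧ IsRankFunction N ∧
      IsSylvesterRank rkS ∧ (∀ x : S, rkS 1 1 (Matrix.of fun _ _ => x) = N x) ∧
      ∀ (m n : ℕ) (A : Matrix (Fin m) (Fin n) R), rk m n A = rkS m n (A.map φ) := by
  set c := h.nullCon
  let π : R →+* c.Quotient := c.mk'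
  have hπ : Function.Surjective π := c.mk'_surjective
  have hker : ∀ x y, π x = π y → rk.elt (x - y) = 0 := fun x y hxy => c.eq.mp hxy
  let σ : c.Quotient → R := Function.surjInv hπ
  have hσ : ∀ y, π (σ y) = y := Function.surjInv_eq hπ
  let rkS : MatrixFunction c.Quotient := fun m n M => rk m n (M.map σ)
  have hlift : ∀ (m n : ℕ) (A : Matrix (Fin m) (Fin n) R), rk m n A = rkS m n (A.map π) := by
    intro m n A
    have h0 := h.abs_onFintype_sub_le A ((A.map π).map σ)
    have h2 := h.onFintype_le_sum_elt (A - (A.map π).map σ)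
    have h3 : ∑ i, ∑ j, rk.elt ((A - (A.map π).map σ) i j) = 0 := by
      refine Finset.sum_eq_zero fun i _ => Finset.sum_eq_zero fun j _ => ?_
      exact hker _ _ (by simp [hσ])
    have h4 := abs_nonpos_iff.mp (h0.trans (h2.trans h3.le))
    rw [h.onFintype_fin, h.onFintype_fin] at h4
    exact sub_eq_zero.mp h4
  have hsurj : ∀ {m n : ℕ} (M : Matrix (Fin m) (Fin n) c.Quotient),
      ∃ A : Matrix (Fin m) (Fin n) R, A.map π = M := fun M =>
    ⟨M.map σ, by ext i j; exact hσ _⟩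
  have hS : IsSylvesterRank rkS :=
    { nonneg := fun m n M => h.nonneg _ _ _
      map_zero := fun m n => by
        rw [← Matrix.map_zero π π.map_zero, ← hlift, h.map_zero]
      map_one := by
        rw [← Matrix.map_one π π.map_zero π.map_one, ← hlift, ← h1]
        congr 1
        ext i j
        rw [Subsingleton.elim i j]
        exact Matrix.one_apply_eq j
      mul_le_left := fun l m n M N => by
        obtain ⟨A, rfl⟩ := hsurj M
        obtain ⟨B, rfl⟩ := hsurj N
        rw [← Matrix.map_mul, ← hlift, ← hlift]
        exact h.mul_le_left _ _ _ _ _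
      mul_le_right := fun l m n M N => by
        obtain ⟨A, rfl⟩ := hsurj M
        obtain ⟨B, rfl⟩ := hsurj N
        rw [← Matrix.map_mul, ← hlift, ← hlift]
        exact h.mul_le_right _ _ _ _ _
      diag_eq := fun m₁ n₁ m₂ n₂ M N => by
        obtain ⟨A, rfl⟩ := hsurj M
        obtain ⟨B, rfl⟩ := hsurj N
        rw [← Matrix.map_zero π π.map_zero, ← blockUpper_map, ← hlift, ← hlift,
          ← hlift]
        exact h.diag_eq _ _ _ _ _ _
      le_upper := fun m₁ n₁ m₂ n₂ M N P => by
        obtain ⟨A, rfl⟩ := hsurj M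
        obtain ⟨B, rfl⟩ := hsurj N
        obtain ⟨C, rfl⟩ := hsurj P
        rw [← blockUpper_map, ← hlift, ← hlift, ← hlift]
        exact h.le_upper _ _ _ _ _ _ _ }
  have hw := hS.isWeakSylvester
  have hone : rkS.elt 1 = 1 := by
    rw [← h1]
    have := hlift 1 1 (Matrix.of fun _ _ => 1)
    refine Eq.trans ?_ this.symm
    unfold MatrixFunction.elt
    congr 1
  refine ⟨c.Quotient, inferInstance, rkS.elt, rkS, π, hR.of_surjective π hπ, ?_, hS,
    fun x => rfl, hlift⟩
  refine ⟨fun x => ⟨hw.elt_nonneg x, (hw.elt_le_one x).trans_eq hone⟩, hone, hw.elt_mul_le_left,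
    hw.elt_mul_le_right, fun e f he hf hef hfe => hw.elt_add_of_orthogonal he hf hef hfe,
    fun x => ⟨fun hx => ?_, fun hx => by rw [hx, hw.elt_zero]⟩⟩
  obtain ⟨y, rfl⟩ := hπ x
  rw [← π.map_zero]
  refine c.eq.mpr ?_
  change rk.elt (y - 0) = 0
  rw [sub_zero, ← hx]
  exact hlift 1 1 (Matrix.of fun _ _ => y)

end quotient

section ultraproduct

theorem Ultrafilter.exists_tendsto_of_bounded {I : Type*} (U : Ultrafilter I) (f : I → ℝ) (C : ℝ)
    (h0 : ∀ i, 0 ≤ f i) (hC : ∀ i, f i ≤ C) : ∃ c, Tendsto f U (𝓝 c) := by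
  obtain ⟨c, -, hc⟩ := (isCompact_Icc (a := (0 : ℝ)) (b := C)).ultrafilter_le_nhds (U.map f)
    (by
      rw [le_principal_iff]
      exact mem_map.mpr (Filter.univ_mem' fun i => ⟨h0 i, hC i⟩))
  exact ⟨c, hc⟩

theorem IsVonNeumannRegular.pi {I : Type a} {S : I → Type b} [∀ i, Ring (S i)]
    (h : ∀ i, IsVonNeumannRegular (S i)) : IsVonNeumannRegular (∀ i, S i) := by
  intro x
  choose y hy using fun i => h i (x i)
  exact ⟨y, funext hy⟩

/-- An ultralimit of uniformly bounded weak Sylvester functions is one, on the product ring. -/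
theorem exists_ultralimit {I : Type a} (U : Ultrafilter I) {S : I → Type b} [∀ i, Ring (S i)]
    (rks : ∀ i, MatrixFunction (S i)) (h : ∀ i, IsWeakSylvester (rks i)) (C : ℝ)
    (hC : ∀ i, (rks i).elt 1 ≤ C) :
    ∃ rk : MatrixFunction (∀ i, S i), IsWeakSylvester rk ∧
      ∀ (m n : ℕ) (M : Matrix (Fin m) (Fin n) (∀ i, S i)),
        Tendsto (fun i => rks i m n (M.map (Pi.evalRingHom S i))) U (𝓝 (rk m n M)) := by
  have hex : ∀ (m n : ℕ) (M : Matrix (Fin m) (Fin n) (∀ i, S i)),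
      ∃ c, Tendsto (fun i => rks i m n (M.map (Pi.evalRingHom S i))) U (𝓝 c) := fun m n M =>
    U.exists_tendsto_of_bounded _ (m * n * C) (fun i => (h i).nonneg _ _ _) fun i =>
      ((h i).le_mul_elt_one _).trans (by gcongr; exact hC i)
  choose rk hrk using hex
  have hi : ∀ i, IsWeakSylvester (fun m n (M : Matrix (Fin m) (Fin n) (∀ i, S i)) =>
      rks i m n (M.map (Pi.evalRingHom S i))) := fun i => (h i).comap _
  refine ⟨rk, ⟨?_, ?_, ?_, ?_, ?_, ?_⟩, hrk⟩
  · exact fun m n M => ge_of_tendsto' (hrk m n M) fun i => (h i).nonneg _ _ _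
  · intro m n
    refine tendsto_nhds_unique (hrk m n 0) ?_
    simp only [(hi _).map_zero]
    exact tendsto_const_nhds
  · exact fun l m n M N => le_of_tendsto_of_tendsto' (hrk _ _ _) (hrk _ _ _) fun i =>
      (hi i).mul_le_left _ _ _ _ _
  · exact fun l m n M N => le_of_tendsto_of_tendsto' (hrk _ _ _) (hrk _ _ _) fun i =>
      (hi i).mul_le_right _ _ _ _ _
  · intro m₁ n₁ m₂ n₂ M N
    refine tendsto_nhds_unique (hrk _ _ _) ?_
    simp only [(hi _).diag_eq]
    exact (hrk _ _ _).add (hrk _ _ _)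
  · exact fun m₁ n₁ m₂ n₂ M N P => le_of_tendsto_of_tendsto' ((hrk _ _ _).add (hrk _ _ _))
      (hrk _ _ _) fun i => (hi i).le_upper _ _ _ _ _ _ _

/-- A matrix function that is approximated on finite sets of matrices by functions induced from
regular rings is itself induced from a regular rank ring, namely from an ultraproduct. -/
theorem exists_regularRankRing_of_approx {R : Type a} [Ring R] (r : MatrixFunction R)
    (hr : r.elt 1 = 1)
    (happ : ∀ (F : Finset (Σ m n : ℕ, Matrix (Fin m) (Fin n) R)) (ε : ℝ), 0 < ε →
      ∃ (S : Type b) (_ : Ring S) (rkS : MatrixFunction S) (φ : R →+* S),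
        IsVonNeumannRegular S ∧ IsWeakSylvester rkS ∧
        ∀ M ∈ F, |r M.1 M.2.1 M.2.2 - rkS M.1 M.2.1 (M.2.2.map φ)| ≤ ε) :
    ∃ (S : Type max a b) (_ : Ring S) (N : S → ℝ) (rkS : MatrixFunction S) (φ : R →+* S),
      IsVonNeumannRegular S ∧ IsRankFunction N ∧
      IsSylvesterRank rkS ∧ (∀ x : S, rkS 1 1 (Matrix.of fun _ _ => x) = N x) ∧
      ∀ (m n : ℕ) (A : Matrix (Fin m) (Fin n) R), r m n A = rkS m n (A.map φ) := by
  classical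
  let Mat := Σ m n : ℕ, Matrix (Fin m) (Fin n) R
  let M₁ : Mat := ⟨1, 1, Matrix.of fun _ _ => 1⟩
  let I := Finset Mat × ℕ
  let U : Ultrafilter I := Ultrafilter.of atTop
  have hU : (U : Filter I) ≤ atTop := Ultrafilter.of_le _
  have happ' := fun i : I => happ (insert M₁ i.1) (1 / ((i.2 : ℝ) + 1)) Nat.one_div_pos_of_nat
  choose S inst rkS φ hreg hw hclose using happ'
  have hbound : ∀ i, (rkS i).elt 1 ≤ 2 := by
    intro i
    have h1 := hclose i M₁ (Finset.mem_insert_self _ _)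
    have h2 : 1 / ((i.2 : ℝ) + 1) ≤ 1 := by
      rw [div_le_one (by positivity)]
      linarith [(Nat.cast_nonneg i.2 : (0 : ℝ) ≤ i.2)]
    have h3 : rkS i 1 1 (M₁.2.2.map (φ i)) = (rkS i).elt 1 := by
      unfold MatrixFunction.elt
      congr 1
      ext
      simp [M₁]
    have h4 : r M₁.1 M₁.2.1 M₁.2.2 = 1 := hr
    rw [h4, h3] at h1
    linarith [(abs_le.mp h1).1]
  obtain ⟨rk, hrk, hlim⟩ := exists_ultralimit U rkS hw 2 hbound
  let Φ : R →+* ∀ i, S i := RingHom.pi φ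
  have heq : ∀ (m n : ℕ) (A : Matrix (Fin m) (Fin n) R), r m n A = rk m n (A.map Φ) := by
    intro m n A
    refine (tendsto_nhds_unique (hlim m n (A.map Φ)) ?_).symm
    rw [tendsto_iff_dist_tendsto_zero]
    have hmem : ∀ᶠ i in (U : Filter I), (⟨m, n, A⟩ : Mat) ∈ i.1 := by
      refine hU ?_
      filter_upwards [eventually_ge_atTop (({⟨m, n, A⟩}, 0) : I)] with i hi
      exact hi.1 (Finset.mem_singleton_self _)
    have hzero : Tendsto (fun i : I => 1 / ((i.2 : ℝ) + 1)) U (𝓝 0) :=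
      (tendsto_one_div_add_atTop_nhds_zero_nat.comp
        (Filter.tendsto_snd.comp (by
          rw [← Filter.prod_atTop_atTop_eq]
          exact tendsto_id))).mono_left hU
    refine squeeze_zero' (Eventually.of_forall fun i => dist_nonneg) ?_ hzero
    filter_upwards [hmem] with i hi
    rw [dist_comm]
    exact hclose i _ (Finset.mem_insert_of_mem hi)
  have hone : rk.elt 1 = 1 := by
    rw [← hr]
    refine Eq.trans ?_ (heq 1 1 (Matrix.of fun _ _ => 1)).symm
    unfold MatrixFunction.elt
    congr 1
    exact Matrix.ext fun i j => (map_one Φ).symm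
  obtain ⟨T, instT, N, rkT, ψ, h1, h2, h3, h4, h5⟩ :=
    hrk.exists_regularRankRing hone (IsVonNeumannRegular.pi hreg)
  refine ⟨T, instT, N, rkT, ψ.comp Φ, h1, h2, h3, h4, fun m n A => ?_⟩
  rw [heq, h5]
  rfl

end ultraproduct

end ultralimits

/-! ### Ranks of matrices of endomorphisms -/

section endomorphisms

open Module

section endRank

variable (K : Type v) [Field K] {V : Type w} [AddCommGroup V] [Module K V]

/-- The linear map `Vⁿ → Vᵐ` given by an `m × n` matrix of endomorphisms of `V`. -/
def endMap {m n : Type*} [Fintype n] (M : Matrix m n (End K V)) : (n → V) →ₗ[K] (m → V) :=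
  LinearMap.pi fun i => ∑ j, M i j ∘ₗ LinearMap.proj j

theorem endMap_apply {m n : Type*} [Fintype n] (M : Matrix m n (End K V)) (x : n → V) (i : m) :
    endMap K M x i = ∑ j, M i j (x j) := by
  simp [endMap]

theorem endMap_mul {l m n : Type*} [Fintype m] [Fintype n] (M : Matrix l m (End K V))
    (N : Matrix m n (End K V)) : endMap K (M * N) = endMap K M ∘ₗ endMap K N := by
  ext1 x
  funext i
  simp only [endMap_apply, Matrix.mul_apply, LinearMap.comp_apply, LinearMap.sum_apply,
    Module.End.mul_apply, map_sum]
  exact Finset.sum_comm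

theorem endMap_zero {m n : Type*} [Fintype n] :
    endMap K (0 : Matrix m n (End K V)) = 0 := by
  ext1 x
  funext i
  simp [endMap_apply]

/-- The rank of a matrix of endomorphisms of `V`, as a linear map `Vⁿ → Vᵐ`. -/
noncomputable def endRank {m n : Type*} [Fintype n] (M : Matrix m n (End K V)) : ℝ :=
  finrank K (LinearMap.range (endMap K M))

theorem finrank_range_equiv_comp {V₁ V₂ V₃ V₄ : Type*} [AddCommGroup V₁] [AddCommGroup V₂]
    [AddCommGroup V₃] [AddCommGroup V₄] [Module K V₁] [Module K V₂] [Module K V₃] [Module K V₄]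
    (e : V₁ ≃ₗ[K] V₂) (f : V₂ →ₗ[K] V₃) (e' : V₃ ≃ₗ[K] V₄) :
    finrank K (LinearMap.range ((e' : V₃ →ₗ[K] V₄) ∘ₗ f ∘ₗ (e : V₁ →ₗ[K] V₂))) =
      finrank K (LinearMap.range f) := by
  rw [LinearMap.range_comp, LinearMap.range_comp_of_range_eq_top _ e.range,
    LinearEquiv.finrank_map_eq]

theorem endRank_submatrix {m n p q : Type*} [Fintype n] [Fintype q]
    (M : Matrix m n (End K V)) (e : p ≃ m) (f : q ≃ n) :
    endRank K (M.submatrix e f) = endRank K M := by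
  have : endMap K (M.submatrix e f) = ((LinearEquiv.funCongrLeft K V e : _ ≃ₗ[K] _) : _ →ₗ[K] _) ∘ₗ
      endMap K M ∘ₗ ((LinearEquiv.funCongrLeft K V f.symm : _ ≃ₗ[K] _) : _ →ₗ[K] _) := by
    ext1 x
    funext i
    simp only [endMap_apply, LinearMap.comp_apply, LinearEquiv.coe_coe,
      LinearEquiv.funCongrLeft_apply, LinearMap.funLeft_apply, Matrix.submatrix_apply]
    exact Fintype.sum_equiv f _ _ fun j => by simp
  rw [endRank, this, finrank_range_equiv_comp, endRank]

section block

variable {W₁ W₂ U₁ U₂ : Type*} [AddCommGroup W₁] [AddCommGroup W₂] [AddCommGroup U₁]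
  [AddCommGroup U₂] [Module K W₁] [Module K W₂] [Module K U₁] [Module K U₂]
  [FiniteDimensional K U₁] [FiniteDimensional K U₂]

theorem finrank_range_upper (A : W₁ →ₗ[K] U₁) (B : W₂ →ₗ[K] U₂) (C : W₂ →ₗ[K] U₁) :
    finrank K (LinearMap.range A) + finrank K (LinearMap.range B) ≤
      finrank K (LinearMap.range ((A.coprod C).prod (B ∘ₗ LinearMap.snd K W₁ W₂))) := by
  set f := (A.coprod C).prod (B ∘ₗ LinearMap.snd K W₁ W₂)
  have hf : ∀ x y, f (x, y) = (A x + C y, B y) := fun x y => by simp [f]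
  set g : LinearMap.range f →ₗ[K] U₂ := (LinearMap.snd K U₁ U₂).domRestrict (LinearMap.range f)
  rw [← g.finrank_range_add_finrank_ker, add_comm]
  refine add_le_add ?_ ?_
  · refine Submodule.finrank_mono ?_
    rintro _ ⟨y, rfl⟩
    exact ⟨⟨f (0, y), ⟨_, rfl⟩⟩, by simp [g, hf]⟩
  · let j : LinearMap.range A →ₗ[K] LinearMap.ker g :=
      LinearMap.codRestrict _ (LinearMap.codRestrict _
        (LinearMap.inl K U₁ U₂ ∘ₗ (LinearMap.range A).subtype) (by
          rintro ⟨_, x, rfl⟩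
          exact ⟨(x, 0), by simp [hf]⟩)) (by
          intro x
          simp [g])
    refine LinearMap.finrank_le_finrank_of_injective (f := j) ?_
    intro x y hxy
    have := congrArg (fun z : LinearMap.ker g => ((z : LinearMap.range f) : U₁ × U₂).1) hxy
    exact Subtype.ext (by simpa [j] using this)

theorem finrank_range_prodMap (A : W₁ →ₗ[K] U₁) (B : W₂ →ₗ[K] U₂) :
    finrank K (LinearMap.range (A.prodMap B)) =
      finrank K (LinearMap.range A) + finrank K (LinearMap.range B) := by
  refine le_antisymm ?_ ?_
  · have : LinearMap.range (A.prodMap B) =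
        LinearMap.range ((LinearMap.range A).subtype.prodMap (LinearMap.range B).subtype) := by
      simp only [LinearMap.range_prodMap, Submodule.range_subtype]
    rw [this, ← Module.finrank_prod]
    exact LinearMap.finrank_range_le _
  · have : A.prodMap B = (A.coprod 0).prod (B ∘ₗ LinearMap.snd K W₁ W₂) :=
      LinearMap.ext fun x => by simp
    rw [this]
    exact finrank_range_upper K A B 0

end block

theorem endRank_blockUpper {m₁ n₁ m₂ n₂ : ℕ} (A : Matrix (Fin m₁) (Fin n₁) (End K V))
    (B : Matrix (Fin m₂) (Fin n₂) (End K V)) (C : Matrix (Fin m₁) (Fin n₂) (End K V)) :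
    endRank K (blockUpper A B C) = finrank K (LinearMap.range
      (((endMap K A).coprod (endMap K C)).prod (endMap K B ∘ₗ LinearMap.snd K _ _))) := by
  rw [blockUpper, Matrix.reindex_apply, endRank_submatrix, endRank,
    ← finrank_range_equiv_comp K (LinearEquiv.sumArrowLequivProdArrow _ _ K V) _
      (LinearEquiv.sumArrowLequivProdArrow _ _ K V).symm]
  have : endMap K (Matrix.fromBlocks A C 0 B) =
      ((LinearEquiv.sumArrowLequivProdArrow (Fin m₁) (Fin m₂) K V).symm : _ →ₗ[K] _) ∘ₗ
        ((endMap K A).coprod (endMap K C)).prod (endMap K B ∘ₗ LinearMap.snd K _ _) ∘ₗ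
        (LinearEquiv.sumArrowLequivProdArrow (Fin n₁) (Fin n₂) K V : _ →ₗ[K] _) := by
    refine LinearMap.ext fun x => funext fun i => ?_
    rcases i with i | i <;> simp [endMap_apply]
  rw [this]

theorem endRank_mul_le_left [FiniteDimensional K V] {l m n : Type*} [Finite l] [Fintype m]
    [Fintype n] (M : Matrix l m (End K V)) (N : Matrix m n (End K V)) :
    endRank K (M * N) ≤ endRank K M := by
  unfold endRank
  rw [endMap_mul, Nat.cast_le]
  exact Submodule.finrank_mono (LinearMap.range_comp_le_range _ _)

theorem endRank_mul_le_right [FiniteDimensional K V] {l m n : Type*} [Fintype m]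
    [Fintype n] (M : Matrix l m (End K V)) (N : Matrix m n (End K V)) :
    endRank K (M * N) ≤ endRank K N := by
  unfold endRank
  rw [endMap_mul, Nat.cast_le, LinearMap.range_comp]
  exact Submodule.finrank_map_le _ _

theorem endRank_isWeakSylvester [FiniteDimensional K V] :
    IsWeakSylvester (fun _ _ M => endRank K M : MatrixFunction (End K V)) where
  nonneg _ _ _ := Nat.cast_nonneg _
  map_zero _ _ := by simp [endRank, endMap_zero]
  mul_le_left _ _ _ M N := endRank_mul_le_left K M N
  mul_le_right _ _ _ M N := endRank_mul_le_right K M N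
  diag_eq _ _ _ _ A B := by
    rw [endRank_blockUpper, endRank, endRank, ← Nat.cast_add, ← finrank_range_prodMap]
    have : (endMap K A).prodMap (endMap K B) = ((endMap K A).coprod (endMap K 0)).prod
        (endMap K B ∘ₗ LinearMap.snd K _ _) := by
      refine LinearMap.ext fun x => ?_
      simp [endMap_zero]
    rw [this]
  le_upper _ _ _ _ A B C := by
    rw [endRank_blockUpper, endRank, endRank, ← Nat.cast_add, Nat.cast_le]
    exact finrank_range_upper K _ _ _

/-- The endomorphism ring of a vector space is von Neumann regular. -/
theorem isVonNeumannRegular_end : IsVonNeumannRegular (End K V) := by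
  intro f
  obtain ⟨s, hs⟩ := f.rangeRestrict.exists_rightInverse_of_surjective f.range_rangeRestrict
  obtain ⟨g, hg⟩ := s.exists_extend
  refine ⟨g, LinearMap.ext fun x => ?_⟩
  have h1 : g (f x) = s (f.rangeRestrict x) := LinearMap.congr_fun hg (f.rangeRestrict x)
  have h2 := congrArg Subtype.val (LinearMap.congr_fun hs (f.rangeRestrict x))
  simp only [Module.End.mul_apply, h1]
  exact h2.symm

end endRank

end endomorphisms

/-! ### Cones of representations, matrix rings and products -/

section representations

open Module

/-- The cone of matrix functions on `R` generated by the ranks of the representations of `R` on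
finite-dimensional `K`-vector spaces. -/
inductive RepCone (K : Type v) [Field K] {R : Type u} [Ring R] : MatrixFunction R → Prop
  | zero : RepCone K (fun _ _ _ => 0)
  | add {r r' : MatrixFunction R} : RepCone K r → RepCone K r' →
      RepCone K (fun m n M => r m n M + r' m n M)
  | rep (c : ℝ) (hc : 0 ≤ c) (V : Type v) [AddCommGroup V] [Module K V] [FiniteDimensional K V]
      (θ : R →+* End K V) : RepCone K (fun _ _ M => c * endRank K (M.map θ))

/-- Every weak Sylvester function on `R` agrees on every finite set of matrices with some member
of the cone spanned by finite-dimensional representations over `K`. -/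
def IsLocallyRepresentable (K : Type v) [Field K] (R : Type u) [Ring R] : Prop :=
  ∀ rk : MatrixFunction R, IsWeakSylvester rk →
    ∀ F : Finset (Σ m n : ℕ, Matrix (Fin m) (Fin n) R), ∃ r : MatrixFunction R, RepCone K r ∧
      ∀ M ∈ F, rk M.1 M.2.1 M.2.2 = r M.1 M.2.1 M.2.2

namespace RepCone

variable {K : Type v} [Field K] {R : Type u} [Ring R]

theorem isWeakSylvester {r : MatrixFunction R} (h : RepCone K r) : IsWeakSylvester r := by
  induction h with
  | zero => exact .zero
  | add _ _ h h' => exact h.add h'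
  | rep c hc V θ => exact ((endRank_isWeakSylvester K).comap θ).smul hc

theorem comap {S : Type w} [Ring S] (f : S →+* R) {r : MatrixFunction R} (h : RepCone K r) :
    RepCone K (fun m n (M : Matrix (Fin m) (Fin n) S) => r m n (M.map f)) := by
  induction h with
  | zero => exact .zero
  | add _ _ h h' => exact h.add h'
  | rep c hc V θ => exact .rep c hc V (θ.comp f)

theorem sum {ι : Type*} (s : Finset ι) {r : ι → MatrixFunction R} (h : ∀ i ∈ s, RepCone K (r i)) :
    RepCone K (fun m n M => ∑ i ∈ s, r i m n M) := by
  classical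
  induction s using Finset.induction_on with
  | empty => simpa using RepCone.zero
  | insert a s ha ih =>
    simp only [Finset.sum_insert ha]
    exact (h a (Finset.mem_insert_self _ _)).add
      (ih fun i hi => h i (Finset.mem_insert_of_mem hi))

/-- Members of the cone are induced from von Neumann regular rings: finite products of
endomorphism rings. -/
theorem exists_regular {r : MatrixFunction R} (h : RepCone K r) :
    ∃ (S : Type v) (_ : Ring S) (rkS : MatrixFunction S) (φ : R →+* S),
      IsVonNeumannRegular S ∧ IsWeakSylvester rkS ∧
      ∀ (m n : ℕ) (M : Matrix (Fin m) (Fin n) R), r m n M = rkS m n (M.map φ) := by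
  induction h with
  | zero =>
    exact ⟨PUnit, inferInstance, fun _ _ _ => 0, ⟨⟨⟨fun _ => 0, rfl⟩, fun _ _ => rfl⟩, rfl,
      fun _ _ => rfl⟩, fun x => ⟨0, rfl⟩, .zero, fun _ _ _ => rfl⟩
  | add _ _ h h' =>
    obtain ⟨S, _, rkS, φ, hS, hw, hφ⟩ := h
    obtain ⟨S', _, rkS', φ', hS', hw', hφ'⟩ := h'
    refine ⟨S × S', inferInstance, _, φ.prod φ', fun x => ?_,
      (hw.comap (RingHom.fst S S')).add (hw'.comap (RingHom.snd S S')), fun m n M => ?_⟩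
    · obtain ⟨y, hy⟩ := hS x.1
      obtain ⟨y', hy'⟩ := hS' x.2
      exact ⟨(y, y'), Prod.ext hy hy'⟩
    · simp only [hφ, hφ']
      rfl
  | rep c hc V θ =>
    exact ⟨End K V, inferInstance, _, θ, isVonNeumannRegular_end K,
      (endRank_isWeakSylvester K).smul hc, fun _ _ _ => rfl⟩

end RepCone

section matrix

variable {K : Type v} [Field K] {D : Type u} [Ring D]

/-- A representation of `D` on `V` yields one of the ring of `k × k` matrices over `D` on
`Vᵏ`. -/
def matrixRep {V : Type w} [AddCommGroup V] [Module K V] (k : ℕ) (θ : D →+* End K V) :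
    Matrix (Fin k) (Fin k) D →+* End K (Fin k → V) where
  toFun N := endMap K (N.map θ)
  map_zero' := by rw [Matrix.map_zero _ θ.map_zero, endMap_zero]
  map_one' := by
    rw [Matrix.map_one _ θ.map_zero θ.map_one]
    refine LinearMap.ext fun x => funext fun i => ?_
    rw [endMap_apply, Finset.sum_eq_single i]
    · simp
    · intro j _ hj
      simp [Matrix.one_apply_ne hj.symm]
    · simp
  map_add' M N := by
    refine LinearMap.ext fun x => funext fun i => ?_
    simp [endMap_apply, Finset.sum_add_distrib]
  map_mul' M N := by
    rw [Matrix.map_mul, endMap_mul]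
    rfl

theorem endRank_matrixRep {V : Type w} [AddCommGroup V] [Module K V] {k : ℕ}
    (θ : D →+* End K V) {m n : ℕ} (M : Matrix (Fin m) (Fin n) (Matrix (Fin k) (Fin k) D)) :
    endRank K (M.map (matrixRep k θ)) = endRank K ((Matrix.comp _ _ _ _ _ M).map θ) := by
  have : endMap K (M.map (matrixRep k θ)) =
      (LinearEquiv.curry K V (Fin m) (Fin k) : _ →ₗ[K] _) ∘ₗ
        endMap K ((Matrix.comp _ _ _ _ _ M).map θ) ∘ₗ
        ((LinearEquiv.curry K V (Fin n) (Fin k)).symm : _ →ₗ[K] _) := by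
    refine LinearMap.ext fun x => funext fun i => funext fun a => ?_
    simp only [endMap_apply, Finset.sum_apply, LinearMap.comp_apply, LinearEquiv.coe_coe,
      LinearEquiv.coe_curry, LinearEquiv.coe_curry_symm, Function.curry_apply,
      Fintype.sum_prod_type]
    refine Finset.sum_congr rfl fun j _ => ?_
    exact endMap_apply K _ _ _
  rw [endRank, this, finrank_range_equiv_comp, endRank]

theorem RepCone.matrix {k : ℕ} {r : MatrixFunction D} (h : RepCone K r) :
    RepCone K (fun m n (M : Matrix (Fin m) (Fin n) (Matrix (Fin k) (Fin k) D)) =>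
      r.onFintype (Matrix.comp _ _ _ _ _ M)) := by
  induction h with
  | zero => exact .zero
  | add _ _ h h' => exact h.add h'
  | rep c hc V θ =>
    have : (fun m n (M : Matrix (Fin m) (Fin n) (Matrix (Fin k) (Fin k) D)) =>
        MatrixFunction.onFintype (fun _ _ M => c * endRank K (M.map θ))
          (Matrix.comp _ _ _ _ _ M)) = fun _ _ M => c * endRank K (M.map (matrixRep k θ)) := by
      funext m n M
      rw [endRank_matrixRep]
      simp only [MatrixFunction.onFintype, ← Matrix.submatrix_map, endRank_submatrix]
    rw [this]
    exact .rep c hc _ (matrixRep k θ)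

/-- The embedding of `D` in the upper left corner of the `(k + 1) × (k + 1)` matrices. -/
def cornerHom (D : Type u) [Ring D] (k : ℕ) :
    D →ₙ+* Matrix (Fin (k + 1)) (Fin (k + 1)) D where
  toFun x := Matrix.single 0 0 x
  map_zero' := Matrix.single_zero _ _
  map_add' x y := Matrix.single_add _ _ _ _
  map_mul' x y := by simp

theorem cornerHom_apply (k : ℕ) (x : D) : cornerHom D k x = Matrix.single 0 0 x := rfl

/-- Weak Sylvester functions on matrix rings are determined by their restriction to the corner. -/
theorem IsWeakSylvester.eq_corner {k : ℕ}
    {rk : MatrixFunction (Matrix (Fin (k + 1)) (Fin (k + 1)) D)} (h : IsWeakSylvester rk)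
    {m n : ℕ} (M : Matrix (Fin m) (Fin n) (Matrix (Fin (k + 1)) (Fin (k + 1)) D)) :
    rk m n M = MatrixFunction.onFintype (fun _ _ N => rk _ _ (N.map (cornerHom D k)))
      (Matrix.comp _ _ _ _ _ M) := by
  let W : ∀ p : ℕ, Matrix (Fin p × Fin (k + 1)) (Fin p)
      (Matrix (Fin (k + 1)) (Fin (k + 1)) D) := fun p =>
    Matrix.of fun x j => if x.1 = j then Matrix.single 0 x.2 1 else 0
  let W' : ∀ p : ℕ, Matrix (Fin p) (Fin p × Fin (k + 1))
      (Matrix (Fin (k + 1)) (Fin (k + 1)) D) := fun p =>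
    Matrix.of fun j x => if x.1 = j then Matrix.single x.2 0 1 else 0
  have hWW : ∀ p, W' p * W p = 1 := fun p => by
    ext1 i j
    simp only [W, W', Matrix.mul_apply, Matrix.of_apply, Fintype.sum_prod_type]
    rw [Finset.sum_eq_single i (fun b _ hb => by simp [hb]) (by simp)]
    by_cases hij : i = j
    · subst hij
      simp only [if_true, Matrix.single_mul_single_same, mul_one, Matrix.one_apply_eq]
      exact Matrix.sum_single_one
    · simp [hij]
  have hflat : W m * M * W' n = (Matrix.comp _ _ _ _ _ M).map (cornerHom D k) := by
    ext1 x y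
    simp only [W, W', Matrix.mul_apply, Matrix.of_apply]
    rw [Finset.sum_eq_single y.1 (fun b _ hb => by simp [hb.symm]) (by simp),
      Finset.sum_eq_single x.1 (fun b _ hb => by simp [hb.symm]) (by simp)]
    simp [cornerHom_apply, Matrix.single_mul_mul_single]
  have hback : M = W' m * (W m * M * W' n) * W n := by
    rw [Matrix.mul_assoc, Matrix.mul_assoc, Matrix.mul_assoc, hWW, ← Matrix.mul_assoc, hWW,
      Matrix.one_mul, Matrix.mul_one]
  have hval : MatrixFunction.onFintype (fun _ _ N => rk _ _ (N.map (cornerHom D k)))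
      (Matrix.comp _ _ _ _ _ M) = rk.onFintype (W m * M * W' n) := by
    rw [hflat]
    rfl
  rw [hval, ← h.onFintype_fin]
  refine le_antisymm ?_ ?_
  · conv_lhs => rw [hback]
    exact (h.onFintype_mul_le_left _ _).trans (h.onFintype_mul_le_right _ _)
  · exact (h.onFintype_mul_le_left _ _).trans (h.onFintype_mul_le_right _ _)

theorem IsLocallyRepresentable.matrix (h : IsLocallyRepresentable K D) (k : ℕ) :
    IsLocallyRepresentable K (Matrix (Fin (k + 1)) (Fin (k + 1)) D) := by
  classical
  intro rk hrk F
  let flat : (Σ m n : ℕ, Matrix (Fin m) (Fin n) (Matrix (Fin (k + 1)) (Fin (k + 1)) D)) →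
      Σ m n : ℕ, Matrix (Fin m) (Fin n) D := fun M => ⟨_, _,
    (Matrix.comp _ _ _ _ _ M.2.2).submatrix (Fintype.equivFin _).symm (Fintype.equivFin _).symm⟩
  obtain ⟨r, hr, hF⟩ := h _ (hrk.comap (cornerHom D k)) (F.image flat)
  refine ⟨_, hr.matrix, fun M hM => ?_⟩
  rw [hrk.eq_corner]
  exact hF (flat M) (Finset.mem_image_of_mem _ hM)

end matrix

section pi

variable {K : Type v} [Field K] {ι : Type a} [DecidableEq ι] {R : ι → Type b}
  [∀ i, Ring (R i)]

/-- The inclusion of a factor into a product of rings, as a non-unital homomorphism. -/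
def Pi.singleNonUnitalRingHom (R : ι → Type b) [∀ i, Ring (R i)] (i : ι) : R i →ₙ+* ∀ i, R i where
  toFun := Pi.single i
  map_zero' := Pi.single_zero i
  map_add' := Pi.single_add i
  map_mul' := Pi.single_mul i

theorem Pi.singleNonUnitalRingHom_apply (i : ι) (x : R i) :
    Pi.singleNonUnitalRingHom R i x = Pi.single i x := rfl

/-- Weak Sylvester functions are additive over orthogonal central idempotents. -/
theorem IsWeakSylvester.sum_central_idempotents {B : Type u} [Ring B] {rk : MatrixFunction B}
    (h : IsWeakSylvester rk) {ι : Type*} [DecidableEq ι] (z : ι → B)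
    (hz : ∀ i, IsIdempotentElem (z i)) (hz' : ∀ i j, i ≠ j → z i * z j = 0)
    (hc : ∀ i x, z i * x = x * z i) {m n : ℕ} (M : Matrix (Fin m) (Fin n) B) (s : Finset ι) :
    rk m n (M.map fun x => (∑ i ∈ s, z i) * x) = ∑ i ∈ s, rk m n (M.map fun x => z i * x) := by
  induction s using Finset.induction_on with
  | empty =>
    have : (M.map fun x => (∑ i ∈ (∅ : Finset ι), z i) * x) = 0 := by
      ext
      simp
    rw [this, h.map_zero, Finset.sum_empty]
  | insert j s hj ih =>
    set t := ∑ i ∈ s, z i with ht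
    have htc : ∀ x, t * x = x * t := fun x => by
      rw [ht, Finset.sum_mul, Finset.mul_sum]
      exact Finset.sum_congr rfl fun i _ => hc i x
    have hjt : z j * t = 0 := by
      rw [ht, Finset.mul_sum]
      exact Finset.sum_eq_zero fun i hi => hz' _ _ fun hji => hj (hji ▸ hi)
    have htj : t * z j = 0 := by rw [htc, hjt]
    have htt : t * t = t := by
      rw [ht, Finset.sum_mul]
      refine Finset.sum_congr rfl fun i hi => ?_
      rw [Finset.mul_sum, Finset.sum_eq_single i (fun k _ hk => hz' _ _ hk.symm)
        (fun hi' => absurd hi hi')]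
      exact hz i
    have hsplit : (M.map fun x => (z j + t) * x) =
        (M.map fun x => z j * x) + (M.map fun x => t * x) := by
      ext
      simp [add_mul]
    have hl : ∀ a b c : B, a * b = c →
        (Matrix.diagonal (fun _ => a) : Matrix (Fin m) (Fin m) B) * (M.map fun x => b * x) =
        M.map fun x => c * x := fun a b c habc => by
      ext
      simp [Matrix.diagonal_mul, ← mul_assoc, habc]
    have hr : ∀ a b c : B, (∀ x, a * x = x * a) → a * b = c →
        (M.map fun x => b * x) * (Matrix.diagonal (fun _ => a) : Matrix (Fin n) (Fin n) B) =
        M.map fun x => c * x := fun a b c hac habc => by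
      ext
      simp [Matrix.mul_diagonal, ← hac, ← mul_assoc, habc]
    have h0 : (M.map fun x => 0 * x) = 0 := by
      ext
      simp
    rw [Finset.sum_insert hj, Finset.sum_insert hj, ← ih, hsplit, ← h.onFintype_fin,
      ← h.onFintype_fin (M.map fun x => z j * x), ← h.onFintype_fin (M.map fun x => t * x)]
    exact h.onFintype_add_of_separated _ _ (Matrix.diagonal fun _ => z j)
      (Matrix.diagonal fun _ => t) (Matrix.diagonal fun _ => z j) (Matrix.diagonal fun _ => t)
      (hl _ _ _ (hz j)) ((hl _ _ _ hjt).trans h0) ((hl _ _ _ htj).trans h0) (hl _ _ _ htt)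
      (hr _ _ _ (hc j) (hz j)) ((hr _ _ _ (hc j) hjt).trans h0) ((hr _ _ _ htc htj).trans h0)
      (hr _ _ _ htc htt)

theorem IsWeakSylvester.eq_sum_pi [Fintype ι] {rk : MatrixFunction (∀ i, R i)}
    (h : IsWeakSylvester rk) {m n : ℕ} (M : Matrix (Fin m) (Fin n) (∀ i, R i)) :
    rk m n M = ∑ i, rk m n ((M.map (Pi.evalRingHom R i)).map (Pi.singleNonUnitalRingHom R i)) := by
  have hmul : ∀ i (x : ∀ i, R i), Pi.single i 1 * x = Pi.single i (x i) := fun i x => by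
    rw [← Pi.single_mul_left, one_mul]
  have hmul' : ∀ i (x : ∀ i, R i), x * Pi.single i 1 = Pi.single i (x i) := fun i x => by
    rw [← Pi.single_mul_right, mul_one]
  have key := h.sum_central_idempotents (fun i : ι => (Pi.single i 1 : ∀ i, R i))
    (fun i => by rw [IsIdempotentElem, hmul, Pi.single_eq_same])
    (fun i j hij => by rw [hmul, Pi.single_eq_of_ne hij, Pi.single_zero])
    (fun i x => by rw [hmul, hmul']) M Finset.univ
  have hone : ∑ i, (Pi.single i 1 : ∀ i, R i) = 1 := Finset.univ_sum_single (1 : ∀ i, R i)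
  rw [hone] at key
  convert key using 2
  · ext
    simp
  · congr 1
    ext1 x y
    simp [Pi.singleNonUnitalRingHom_apply, hmul]

theorem IsLocallyRepresentable.pi [Fintype ι] (h : ∀ i, IsLocallyRepresentable K (R i)) :
    IsLocallyRepresentable K (∀ i, R i) := by
  classical
  intro rk hrk F
  have h' := fun i => h i _ (hrk.comap (Pi.singleNonUnitalRingHom R i))
    (F.image fun M => ⟨M.1, M.2.1, M.2.2.map (Pi.evalRingHom R i)⟩)
  choose r hr hF using h'
  refine ⟨_, RepCone.sum Finset.univ fun i _ => (hr i).comap (Pi.evalRingHom R i),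
    fun M hM => ?_⟩
  rw [hrk.eq_sum_pi]
  exact Finset.sum_congr rfl fun i _ => hF i _ (Finset.mem_image_of_mem _ hM)

end pi

end representations

/-! ### Rank functions on commutative rings and principal ideal domains -/

section principalIdealRings

open Module

namespace IsWeakSylvester

section twoByTwo

variable {R : Type u} [Ring R] {rk : MatrixFunction R}

theorem submatrix_fin_two {R : Type*} (a b c d : R) :
    (!![a, b; c, d] : Matrix (Fin 2) (Fin 2) R).submatrix finSumFinEquiv finSumFinEquiv =
      Matrix.fromBlocks (Matrix.of fun (_ _ : Fin 1) => a) (Matrix.of fun (_ _ : Fin 1) => b)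
        (Matrix.of fun (_ _ : Fin 1) => c) (Matrix.of fun (_ _ : Fin 1) => d) := by
  ext (i | i) (j | j) <;> rw [Subsingleton.elim i 0, Subsingleton.elim j 0] <;> rfl

theorem matrix_fin_two_congr {R : Type*} {a b c d a' b' c' d' : R} (ha : a = a') (hb : b = b')
    (hc : c = c') (hd : d = d') : !![a, b; c, d] = !![a', b'; c', d'] := by
  rw [ha, hb, hc, hd]

theorem onFintype_diag_two (h : IsWeakSylvester rk) (a b : R) :
    rk.onFintype !![a, 0; 0, b] = rk.elt a + rk.elt b := by
  rw [← h.onFintype_submatrix (!![a, 0; 0, b] : Matrix (Fin 2) (Fin 2) R)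
    (finSumFinEquiv : Fin 1 ⊕ Fin 1 ≃ Fin 2) (finSumFinEquiv : Fin 1 ⊕ Fin 1 ≃ Fin 2),
    submatrix_fin_two]
  refine Eq.trans ?_ ((h.onFintype_fromBlocks_diag (Matrix.of fun (_ _ : Fin 1) => a)
    (Matrix.of fun (_ _ : Fin 1) => b)).trans (by rw [h.elt_eq, h.elt_eq]))
  rfl

theorem elt_add_elt_le_upper (h : IsWeakSylvester rk) (a b c : R) :
    rk.elt a + rk.elt b ≤ rk.onFintype !![a, c; 0, b] := by
  rw [← h.onFintype_submatrix (!![a, c; 0, b] : Matrix (Fin 2) (Fin 2) R)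
    (finSumFinEquiv : Fin 1 ⊕ Fin 1 ≃ Fin 2) (finSumFinEquiv : Fin 1 ⊕ Fin 1 ≃ Fin 2),
    submatrix_fin_two, ← h.elt_eq (m := Fin 1) (n := Fin 1) a,
    ← h.elt_eq (m := Fin 1) (n := Fin 1) b]
  exact h.onFintype_fromBlocks_le (Matrix.of fun (_ _ : Fin 1) => a)
    (Matrix.of fun (_ _ : Fin 1) => b) (Matrix.of fun (_ _ : Fin 1) => c)

theorem onFintype_mul_mul_le (h : IsWeakSylvester rk) {l m n p : Type*} [Fintype l] [Fintype m]
    [Fintype n] [Fintype p] (P : Matrix l m R) (M : Matrix m n R) (Q : Matrix n p R) :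
    rk.onFintype (P * M * Q) ≤ rk.onFintype M :=
  (h.onFintype_mul_le_left _ _).trans (h.onFintype_mul_le_right _ _)

theorem onFintype_diagonal_sum (h : IsWeakSylvester rk) {m n : Type*} [Fintype m] [Fintype n]
    [DecidableEq m] [DecidableEq n] (d : m → R) (d' : n → R) :
    rk.onFintype (Matrix.diagonal (Sum.elim d d')) =
      rk.onFintype (Matrix.diagonal d) + rk.onFintype (Matrix.diagonal d') := by
  rw [← Matrix.fromBlocks_diagonal, h.onFintype_fromBlocks_diag]

theorem onFintype_diagonal (h : IsWeakSylvester rk) {n : ℕ} (d : Fin n → R) :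
    rk.onFintype (Matrix.diagonal d) = ∑ i, rk.elt (d i) := by
  induction n with
  | zero =>
    rw [Finset.univ_eq_empty, Finset.sum_empty, ← h.onFintype_zero (m := Fin 0) (n := Fin 0)]
    congr 1
    ext i
    exact i.elim0
  | succ n ih =>
    rw [Fin.sum_univ_castSucc, ← ih, ← h.elt_eq (m := Fin 1) (n := Fin 1),
      ← h.onFintype_submatrix (Matrix.diagonal d) finSumFinEquiv finSumFinEquiv,
      Matrix.submatrix_diagonal_equiv]
    have : d ∘ finSumFinEquiv = Sum.elim (fun i : Fin n => d i.castSucc)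
        (fun _ : Fin 1 => d (Fin.last n)) := by
      funext x
      rcases x with x | x
      · rfl
      · rw [Subsingleton.elim x 0]
        rfl
    rw [this, h.onFintype_diagonal_sum]
    congr 2
    ext i j
    rw [Subsingleton.elim i j]
    simp

end twoByTwo

section comm

variable {D : Type u} [CommRing D] {rk : MatrixFunction D}

/-- For coprime `a` and `b`, the matrices `diag(a, b)` and `diag(1, a b)` are equivalent. -/
theorem elt_mul_of_isCoprime (h : IsWeakSylvester rk) {a b : D} (hab : IsCoprime a b) :
    rk.elt (a * b) + rk.elt 1 = rk.elt a + rk.elt b := by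
  obtain ⟨u, v, huv⟩ := hab
  rw [add_comm, ← h.onFintype_diag_two, ← h.onFintype_diag_two]
  refine le_antisymm ?_ ?_
  · have : !![1, 0; 0, a * b] =
        !![1, 1; -(v * b), u * a] * !![a, 0; 0, b] * !![u, -b; v, a] := by
      simp only [Matrix.mul_fin_two]
      refine matrix_fin_two_congr ?_ ?_ ?_ ?_
      · linear_combination -huv
      · ring
      · ring
      · linear_combination (-(a * b)) * huv
    rw [this]
    exact h.onFintype_mul_mul_le _ _ _
  · have : !![a, 0; 0, b] =
        !![u * a, -1; v * b, 1] * !![1, 0; 0, a * b] * !![a, b; -v, u] := by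
      simp only [Matrix.mul_fin_two]
      refine matrix_fin_two_congr ?_ ?_ ?_ ?_
      · linear_combination (-a) * huv
      · ring
      · ring
      · linear_combination (-b) * huv
    rw [this]
    exact h.onFintype_mul_mul_le _ _ _

/-- Convexity of the rank along the powers of `p`: up to invertible factors,
`diag(y, y p²)` is the triangular matrix with diagonal `(y p, y p)` and corner `y`. -/
theorem two_mul_elt_le (h : IsWeakSylvester rk) (y p : D) :
    2 * rk.elt (y * p) ≤ rk.elt y + rk.elt (y * p ^ 2) := by
  rw [← h.onFintype_diag_two, two_mul]
  refine (h.elt_add_elt_le_upper _ _ y).trans ?_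
  have : !![y * p, y; 0, y * p] = !![1, 0; p, 1] * !![y, 0; 0, y * p ^ 2] * !![p, 1; -1, 0] := by
    simp only [Matrix.mul_fin_two]
    refine matrix_fin_two_congr ?_ ?_ ?_ ?_
    · ring
    · ring
    · ring
    · ring
  rw [this]
  exact h.onFintype_mul_mul_le _ _ _

theorem elt_eq_of_associated (h : IsWeakSylvester rk) {a b : D} (hab : Associated a b) :
    rk.elt a = rk.elt b := by
  obtain ⟨u, rfl⟩ := hab
  refine le_antisymm ?_ (h.elt_mul_le_left _ _)
  simpa using h.elt_mul_le_left (a * u) (↑u⁻¹ : D)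

/-- The corank is additive over products of pairwise coprime elements. -/
theorem elt_one_sub_elt_prod (h : IsWeakSylvester rk) {ι : Type*} (s : Finset ι) (x : ι → D)
    (hx : (s : Set ι).Pairwise fun i j => IsCoprime (x i) (x j)) :
    rk.elt 1 - rk.elt (∏ i ∈ s, x i) = ∑ i ∈ s, (rk.elt 1 - rk.elt (x i)) := by
  classical
  induction s using Finset.induction_on with
  | empty => simp
  | insert j s hj ih =>
    have hc : IsCoprime (x j) (∏ i ∈ s, x i) := IsCoprime.prod_right fun i hi =>
      hx (Finset.mem_insert_self _ _) (Finset.mem_insert_of_mem hi) fun hji => hj (hji ▸ hi)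
    rw [Finset.prod_insert hj, Finset.sum_insert hj,
      ← ih (hx.mono fun i hi => Finset.mem_insert_of_mem hi)]
    linarith [h.elt_mul_of_isCoprime hc]

/-- By the Smith normal form, weak Sylvester functions on a principal ideal domain are determined
by their values on elements. -/
theorem exists_eq_sum_elt [IsDomain D] [IsPrincipalIdealRing D] {m n : ℕ}
    (M : Matrix (Fin m) (Fin n) D) : ∃ (k : ℕ) (d : Fin k → D), ∀ rk : MatrixFunction D,
      IsWeakSylvester rk → rk m n M = ∑ i, rk.elt (d i) := by
  obtain ⟨k, bM, bN, f, d, hd⟩ :=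
    (LinearMap.range M.toLin').smithNormalForm (Pi.basisFun D (Fin m))
  refine ⟨k, d, fun rk h => ?_⟩
  let U : Matrix (Fin m) (Fin k) D := Matrix.of fun x i => bM (f i) x
  let U' : Matrix (Fin k) (Fin m) D := Matrix.of fun i x => bM.repr (Pi.single x 1) (f i)
  have hcol : ∀ j, M.col j ∈ LinearMap.range M.toLin' := fun j =>
    ⟨Pi.single j 1, by simp⟩
  let C : Matrix (Fin k) (Fin n) D := Matrix.of fun i j => bN.repr ⟨M.col j, hcol j⟩ i
  choose w hw using fun i => (bN i).2
  let C' : Matrix (Fin n) (Fin k) D := Matrix.of fun j i => w i j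
  have hM : M = U * Matrix.diagonal d * C := by
    ext x j
    have h1 := congrArg (fun z : LinearMap.range M.toLin' => (z : Fin m → D) x)
      (bN.sum_repr ⟨M.col j, hcol j⟩)
    simp only [Submodule.coe_sum, Submodule.coe_smul, hd, Finset.sum_apply, Pi.smul_apply,
      smul_eq_mul] at h1
    rw [Matrix.mul_apply]
    simp only [Matrix.mul_diagonal, U, C, Matrix.of_apply]
    refine Eq.trans h1.symm (Finset.sum_congr rfl fun i _ => by ring)
  have hU : U' * U = 1 := by
    ext i i'
    have h1 : bM.repr (∑ x, bM (f i') x • (Pi.single x 1 : Fin m → D)) (f i) =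
        bM.repr (bM (f i')) (f i) := by
      rw [← pi_eq_sum_univ']
    simp only [map_sum, map_smul, Finsupp.coe_finsetSum, Finset.sum_apply, Finsupp.coe_smul,
      Pi.smul_apply, smul_eq_mul, Basis.repr_self] at h1
    rw [Matrix.mul_apply]
    simp only [U, U', Matrix.of_apply]
    simp only [mul_comm] at h1 ⊢
    rw [h1, Finsupp.single_apply, Matrix.one_apply]
    simp [eq_comm]
  have hC : C * C' = 1 := by
    ext i i'
    have h1 : bN.repr (∑ j, w i' j • ⟨M.col j, hcol j⟩) i = bN.repr (bN i') i := by
      congr 2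
      refine Subtype.ext ?_
      rw [← hw i', Submodule.coe_sum]
      funext x
      simp [Matrix.mulVec, dotProduct, mul_comm]
    simp only [map_sum, map_smul, Finsupp.coe_finsetSum, Finset.sum_apply, Finsupp.coe_smul,
      Pi.smul_apply, smul_eq_mul, Basis.repr_self] at h1
    rw [Matrix.mul_apply]
    simp only [C, C', Matrix.of_apply]
    simp only [mul_comm] at h1 ⊢
    rw [h1, Finsupp.single_apply, Matrix.one_apply]
    simp [eq_comm]
  have hdiag : Matrix.diagonal d = U' * M * C' := by
    rw [hM]
    simp only [Matrix.mul_assoc, hC, Matrix.mul_one]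
    rw [← Matrix.mul_assoc, hU, Matrix.one_mul]
  rw [← h.onFintype_fin, ← h.onFintype_diagonal]
  refine le_antisymm ?_ ?_
  · conv_lhs => rw [hM]
    exact h.onFintype_mul_mul_le _ _ _
  · rw [hdiag]
    exact h.onFintype_mul_mul_le _ _ _

end comm

end IsWeakSylvester

end principalIdealRings

/-! ### Rank functions on polynomial rings -/

section polynomials

open Module Polynomial UniqueFactorizationMonoid

section polynomialRep

variable {K : Type v} [Field K]

/-- The representation of `K[X]` on `K[X] ⧸ (f)` by multiplication. -/
noncomputable def quotRep (f : K[X]) : K[X] →+* End K (K[X] ⧸ Ideal.span {f}) :=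
  (Algebra.lsmul K K (K[X] ⧸ Ideal.span {f})).toRingHom

theorem quotRep_apply (f g x : K[X]) :
    quotRep f g (Ideal.Quotient.mk _ x) = Ideal.Quotient.mk _ (g * x) := rfl

theorem finiteDimensional_quot {f : K[X]} (hf : f ≠ 0) :
    FiniteDimensional K (K[X] ⧸ Ideal.span {f}) :=
  (AdjoinRoot.powerBasis hf).finite

theorem finrank_quot (f : K[X]) : finrank K (K[X] ⧸ Ideal.span {f}) = f.natDegree :=
  finrank_quotient_span_eq_natDegree

theorem endRank_of_const {V : Type w} [AddCommGroup V] [Module K V] (g : End K V) :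
    endRank K (Matrix.of fun (_ _ : Fin 1) => g) = finrank K (LinearMap.range g) := by
  have : endMap K (Matrix.of fun (_ _ : Fin 1) => g) =
      ((LinearEquiv.funUnique (Fin 1) K V).symm : _ →ₗ[K] _) ∘ₗ g ∘ₗ
        (LinearEquiv.funUnique (Fin 1) K V : _ →ₗ[K] _) := by
    refine LinearMap.ext fun x => funext fun i => ?_
    rw [Subsingleton.elim i 0]
    simp [endMap_apply]
  rw [endRank, this, finrank_range_equiv_comp]

theorem finrank_range_quotRep_of_isCoprime {f g : K[X]} (h : IsCoprime g f) :
    finrank K (LinearMap.range (quotRep f g)) = f.natDegree := by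
  rw [← finrank_quot f, LinearMap.range_eq_top.mpr, finrank_top]
  obtain ⟨u, v, huv⟩ := h
  intro y
  obtain ⟨x, rfl⟩ := Ideal.Quotient.mk_surjective y
  refine ⟨Ideal.Quotient.mk _ (u * x), ?_⟩
  rw [quotRep_apply, Ideal.Quotient.eq, Ideal.mem_span_singleton]
  exact ⟨-(v * x), by linear_combination x * huv⟩

theorem finrank_range_quotRep_of_mul {g h : K[X]} (hg : g ≠ 0) :
    finrank K (LinearMap.range (quotRep (g * h) g)) = h.natDegree := by
  let φ : K[X] →ₗ[K[X]] K[X] ⧸ Ideal.span {g * h} :=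
    (Ideal.Quotient.mkₐ K[X] (Ideal.span {g * h})).toLinearMap ∘ₗ LinearMap.mulLeft K[X] g
  have hφ : ∀ x, φ x = quotRep (g * h) g (Ideal.Quotient.mk _ x) := fun x => rfl
  have hker : LinearMap.ker φ = Ideal.span {h} := by
    ext x
    rw [LinearMap.mem_ker, hφ, quotRep_apply, Ideal.Quotient.eq_zero_iff_mem,
      Ideal.mem_span_singleton, Ideal.mem_span_singleton, mul_dvd_mul_iff_left hg]
  have hrange : (LinearMap.range φ).restrictScalars K = LinearMap.range (quotRep (g * h) g) := by
    ext y
    simp only [Submodule.restrictScalars_mem, LinearMap.mem_range, hφ]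
    constructor
    · rintro ⟨x, rfl⟩
      exact ⟨_, rfl⟩
    · rintro ⟨z, rfl⟩
      obtain ⟨x, rfl⟩ := Ideal.Quotient.mk_surjective z
      exact ⟨x, rfl⟩
  rw [← hrange, ← finrank_quot h, ← hker]
  exact (φ.quotKerEquivRange.restrictScalars K).finrank_eq.symm

theorem quotRep_eq_zero_of_dvd {f g : K[X]} (h : f ∣ g) : quotRep f g = 0 := by
  refine LinearMap.ext fun y => ?_
  obtain ⟨x, rfl⟩ := Ideal.Quotient.mk_surjective y
  rw [quotRep_apply, LinearMap.zero_apply, Ideal.Quotient.eq_zero_iff_mem,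
    Ideal.mem_span_singleton]
  exact h.mul_right x

theorem finrank_range_quotRep_pow {p : K[X]} (hp : p ≠ 0) (j k : ℕ) :
    (finrank K (LinearMap.range (quotRep (p ^ j) (p ^ k))) : ℝ) =
      p.natDegree * ((j : ℝ) - min (k : ℝ) j) := by
  rcases le_total k j with h | h
  · obtain ⟨i, rfl⟩ := Nat.exists_eq_add_of_le h
    rw [pow_add, finrank_range_quotRep_of_mul (pow_ne_zero k hp), natDegree_pow]
    have : (k : ℝ) ≤ ((k + i : ℕ) : ℝ) := by exact_mod_cast h
    rw [min_eq_left this]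
    push_cast
    ring
  · rw [quotRep_eq_zero_of_dvd (pow_dvd_pow p h)]
    have : (j : ℝ) ≤ (k : ℝ) := by exact_mod_cast h
    rw [min_eq_right this, sub_self, mul_zero, Nat.cast_eq_zero]
    rw [LinearMap.range_eq_bot.mpr rfl, finrank_bot]

/-- A sequence starting at `0` is recovered from its negated second differences by summation against
`min k j`, up to a boundary term. -/
theorem sum_second_difference (δ : ℕ → ℝ) (h0 : δ 0 = 0) (J k : ℕ) :
    ∑ j ∈ Finset.range J, (2 * δ (j + 1) - δ (j + 2) - δ j) * min (k : ℝ) ((j + 1 : ℕ) : ℝ) +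
      min (k : ℝ) (J : ℝ) * (δ (J + 1) - δ J) = δ (min k J) := by
  induction J with
  | zero => simp [h0]
  | succ J ih =>
    rw [Finset.sum_range_succ]
    rcases le_or_gt k J with h | h
    · have h1 : min (k : ℝ) (J : ℝ) = k := min_eq_left (by exact_mod_cast h)
      have h2 : min (k : ℝ) ((J + 1 : ℕ) : ℝ) = k :=
        min_eq_left (by exact_mod_cast h.trans (Nat.le_succ J))
      rw [min_eq_left h, h1] at ih
      rw [min_eq_left (h.trans (Nat.le_succ J)), h2, ← ih]
      ring
    · have h1 : min (k : ℝ) (J : ℝ) = J := min_eq_right (by exact_mod_cast h.le)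
      have h2 : min (k : ℝ) ((J + 1 : ℕ) : ℝ) = ((J + 1 : ℕ) : ℝ) :=
        min_eq_right (by exact_mod_cast h)
      rw [min_eq_right h.le, h1] at ih
      rw [min_eq_right (show J + 1 ≤ k from h), h2]
      push_cast at ih ⊢
      linear_combination ih

/-- On finitely many polynomials, a weak Sylvester function agrees with a combination of the
ranks of the multiplications on `K[X] ⧸ (p ^ j)`, with `p` running over the prime factors, and on
one more quotient on which all nonzero given polynomials are invertible. -/
theorem exists_repCone_elt_eq {rk : MatrixFunction K[X]} (h : IsWeakSylvester rk)
    (F : Finset K[X]) : ∃ r : MatrixFunction K[X], RepCone K r ∧ ∀ d ∈ F, rk.elt d = r.elt d := by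
  classical
  let P : Finset K[X] := F.biUnion fun d => (normalizedFactors d).toFinset
  let e : K[X] → K[X] → ℕ := fun d p => (normalizedFactors d).count p
  let J : ℕ := F.sup fun d => (normalizedFactors d).card
  have hPirr : ∀ p ∈ P, Irreducible p := fun p hp => by
    obtain ⟨d, -, hd⟩ := Finset.mem_biUnion.mp hp
    exact irreducible_of_normalized_factor p (Multiset.mem_toFinset.mp hd)
  have hP0 : ∀ p ∈ P, p ≠ 0 := fun p hp => (hPirr p hp).ne_zero
  have hPcop : (P : Set K[X]).Pairwise IsCoprime := fun p hp q hq hpq => by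
    refine ((hPirr p hp).coprime_iff_not_dvd).mpr fun hdvd => hpq ?_
    obtain ⟨d, -, hd⟩ := Finset.mem_biUnion.mp hp
    obtain ⟨d', -, hd'⟩ := Finset.mem_biUnion.mp hq
    have hass := (hPirr p hp).associated_of_dvd (hPirr q hq) hdvd
    rw [← normalize_normalized_factor p (Multiset.mem_toFinset.mp hd),
      ← normalize_normalized_factor q (Multiset.mem_toFinset.mp hd')]
    exact normalize_eq_normalize_iff_associated.mpr hass
  have heJ : ∀ d ∈ F, ∀ p, e d p ≤ J := fun d hd p =>
    (Multiset.count_le_card _ _).trans (Finset.le_sup (f := fun d => (normalizedFactors d).card) hd)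
  -- the product formula for weak Sylvester functions
  have hprod : ∀ (s : MatrixFunction K[X]), IsWeakSylvester s → ∀ k : K[X] → ℕ,
      s.elt 1 - s.elt (∏ p ∈ P, p ^ k p) = ∑ p ∈ P, (s.elt 1 - s.elt (p ^ k p)) :=
    fun s hs k => hs.elt_one_sub_elt_prod P _ fun p hp q hq hpq =>
      (hPcop hp hq hpq).pow
  have hfact : ∀ d ∈ F, d ≠ 0 → Associated (∏ p ∈ P, p ^ e d p) d := fun d hd hd0 => by
    have h1 := prod_normalizedFactors hd0
    rw [Finset.prod_multiset_count] at h1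
    refine (Finset.prod_subset (f := fun p => p ^ e d p) (Finset.subset_biUnion_of_mem
      (fun d => (normalizedFactors d).toFinset) hd) fun p _ hp => ?_) ▸ h1
    change p ^ Multiset.count p (normalizedFactors d) = 1
    rw [Multiset.count_eq_zero_of_notMem fun hp' => hp (Multiset.mem_toFinset.mpr hp'),
      pow_zero]
  -- the corank of the powers of `p`, a concave increasing function, made constant from `J` on; its
  -- negated second differences are the weights of the representations on `K[X] ⧸ (p ^ j)`
  let w : ℝ := rk.elt 1
  let δ : K[X] → ℕ → ℝ := fun p k => w - rk.elt (p ^ min k J)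
  have hδ0 : ∀ p, δ p 0 = 0 := fun p => by simp [δ, w]
  have hδmono : ∀ p k, δ p k ≤ δ p (k + 1) := fun p k => by
    simp only [δ]
    have : p ^ min (k + 1) J = p ^ min k J * p ^ (min (k + 1) J - min k J) := by
      rw [← pow_add]
      congr 1
      omega
    rw [this]
    linarith [h.elt_mul_le_left (p ^ min k J) (p ^ (min (k + 1) J - min k J))]
  have hδconc : ∀ p, ∀ j ∈ Finset.range J, 0 ≤ 2 * δ p (j + 1) - δ p (j + 2) - δ p j :=
    fun p j hj => by
      have hj' : j + 1 ≤ J := Finset.mem_range.mp hj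
      rcases eq_or_lt_of_le hj' with hJ | hJ
      · have h1 : δ p (j + 2) = δ p (j + 1) := by
          simp only [δ]
          congr 3
          omega
        rw [h1]
        linarith [hδmono p j]
      · have h1 := h.two_mul_elt_le (p ^ j) p
        simp only [δ]
        rw [min_eq_left hj', min_eq_left (show j + 2 ≤ J from hJ),
          min_eq_left (show j ≤ J by omega)]
        rw [← pow_succ, ← pow_add] at h1
        linarith
  -- the mass not yet used up, the weight of the quotient on which the polynomials are invertible
  let c₀ : ℝ := w - ∑ p ∈ P, δ p J
  have hc₀ : 0 ≤ c₀ := by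
    have h1 := hprod rk h fun _ => J
    have h2 : ∑ p ∈ P, δ p J = ∑ p ∈ P, (rk.elt 1 - rk.elt (p ^ J)) := by
      simp only [δ, w, min_self]
    have h3 := h.elt_nonneg (∏ p ∈ P, p ^ J)
    simp only [c₀, h2, ← h1, w]
    linarith
  -- a polynomial of positive degree, prime to all the given factors
  let f₀ : K[X] := X * ∏ p ∈ P, p + 1
  have hprod0 : ∏ p ∈ P, p ≠ 0 := Finset.prod_ne_zero_iff.mpr hP0
  have hf₀deg : 0 < f₀.natDegree := by
    have h1 : f₀.natDegree = (X * ∏ p ∈ P, p).natDegree := by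
      simp only [f₀]
      rw [← C_1, natDegree_add_C]
    rw [h1, natDegree_X_mul hprod0]
    exact Nat.succ_pos _
  have hf₀ : f₀ ≠ 0 := fun hf => by simp [hf] at hf₀deg
  have hf₀cop : ∀ p ∈ P, ∀ k : ℕ, IsCoprime (p ^ k) f₀ := fun p hp k => by
    refine IsCoprime.pow_left ⟨-(X * ∏ q ∈ P.erase p, q), 1, ?_⟩
    simp only [f₀]
    rw [← Finset.mul_prod_erase P (fun q => q) hp]
    ring
  let rep : K[X] → MatrixFunction K[X] := fun f _ _ M => endRank K (M.map (quotRep f))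
  have hrep : ∀ f d, (rep f).elt d = finrank K (LinearMap.range (quotRep f d)) := fun f d =>
    endRank_of_const (quotRep f d)
  let r : MatrixFunction K[X] := fun m n M =>
    ∑ p ∈ P, ∑ j ∈ Finset.range J,
      (2 * δ p (j + 1) - δ p (j + 2) - δ p j) / p.natDegree * rep (p ^ (j + 1)) m n M +
    c₀ / f₀.natDegree * rep f₀ m n M
  have hr : RepCone K r := by
    refine RepCone.add (RepCone.sum P fun p hp => RepCone.sum _ fun j hj => ?_) ?_
    · have := finiteDimensional_quot (pow_ne_zero (j + 1) (hP0 p hp))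
      exact .rep _ (div_nonneg (hδconc p j hj) (Nat.cast_nonneg _)) _ _
    · have := finiteDimensional_quot hf₀
      exact .rep _ (div_nonneg hc₀ (Nat.cast_nonneg _)) _ _
  have hsum : ∀ p (k : ℕ), ∑ j ∈ Finset.range J,
      (2 * δ p (j + 1) - δ p (j + 2) - δ p j) * min (k : ℝ) ((j + 1 : ℕ) : ℝ) =
        δ p (min k J) := fun p k => by
    have h1 := sum_second_difference (δ p) (hδ0 p) J k
    have h2 : δ p (J + 1) = δ p J := by
      simp only [δ]
      congr 3
      omega
    rwa [h2, sub_self, mul_zero, add_zero] at h1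
  have hsumJ : ∀ p, ∑ j ∈ Finset.range J,
      (2 * δ p (j + 1) - δ p (j + 2) - δ p j) * ((j + 1 : ℕ) : ℝ) = δ p J := fun p => by
    rw [← (congrArg (δ p) (min_self J) : δ p (min J J) = δ p J), ← hsum p J]
    refine Finset.sum_congr rfl fun j hj => ?_
    rw [min_eq_right]
    exact_mod_cast Finset.mem_range.mp hj
  have hdeg : ∀ p ∈ P, (p.natDegree : ℝ) ≠ 0 := fun p hp => by
    exact_mod_cast (hPirr p hp).natDegree_pos.ne'
  have hr1 : r.elt 1 = w := by
    have h1 : r.elt 1 = ∑ p ∈ P, ∑ j ∈ Finset.range J,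
        (2 * δ p (j + 1) - δ p (j + 2) - δ p j) / p.natDegree * (rep (p ^ (j + 1))).elt 1 +
        c₀ / f₀.natDegree * (rep f₀).elt 1 := rfl
    have h2 : ∀ p ∈ P, ∑ j ∈ Finset.range J, (2 * δ p (j + 1) - δ p (j + 2) - δ p j) /
        p.natDegree * (rep (p ^ (j + 1))).elt 1 = δ p J := fun p hp => by
      rw [← hsumJ p]
      refine Finset.sum_congr rfl fun j _ => ?_
      rw [hrep, finrank_range_quotRep_of_isCoprime isCoprime_one_left, natDegree_pow]
      push_cast
      field_simp [hdeg p hp]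
    rw [h1, Finset.sum_congr rfl h2, hrep, finrank_range_quotRep_of_isCoprime isCoprime_one_left]
    have : (f₀.natDegree : ℝ) ≠ 0 := by exact_mod_cast hf₀deg.ne'
    rw [div_mul_cancel₀ _ this]
    simp only [c₀]
    ring
  have hrp : ∀ p ∈ P, ∀ k ≤ J, r.elt (p ^ k) = rk.elt (p ^ k) := fun p hp k hk => by
    have h1 : ∀ d, r.elt d = ∑ p ∈ P, ∑ j ∈ Finset.range J,
        (2 * δ p (j + 1) - δ p (j + 2) - δ p j) / p.natDegree * (rep (p ^ (j + 1))).elt d +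
        c₀ / f₀.natDegree * (rep f₀).elt d := fun d => rfl
    have h2 : r.elt 1 - r.elt (p ^ k) = δ p k := by
      rw [h1, h1, add_sub_add_comm, ← Finset.sum_sub_distrib]
      have h3 : (rep f₀).elt (p ^ k) = (rep f₀).elt 1 := by
        rw [hrep, hrep, finrank_range_quotRep_of_isCoprime (hf₀cop p hp k),
          finrank_range_quotRep_of_isCoprime isCoprime_one_left]
      rw [h3, sub_self, add_zero, Finset.sum_eq_single p]
      · rw [← Finset.sum_sub_distrib, ← (congrArg (δ p) (min_eq_left hk) :), ← hsum p k]
        refine Finset.sum_congr rfl fun j _ => ?_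
        rw [hrep, hrep, finrank_range_quotRep_pow (hP0 p hp),
          finrank_range_quotRep_of_isCoprime isCoprime_one_left, natDegree_pow]
        push_cast
        field_simp [hdeg p hp]
        ring
      · intro q hq hqp
        rw [sub_eq_zero]
        refine Finset.sum_congr rfl fun j _ => ?_
        rw [hrep, hrep, finrank_range_quotRep_of_isCoprime (hPcop hp hq hqp.symm).pow,
          finrank_range_quotRep_of_isCoprime isCoprime_one_left]
      · exact fun hp' => absurd hp hp'
    rw [hr1] at h2
    simp only [δ, min_eq_left hk] at h2
    linarith
  refine ⟨r, hr, fun d hd => ?_⟩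
  by_cases hd0 : d = 0
  · rw [hd0, h.elt_zero, hr.isWeakSylvester.elt_zero]
  · rw [← h.elt_eq_of_associated (hfact d hd hd0),
      ← hr.isWeakSylvester.elt_eq_of_associated (hfact d hd hd0)]
    have h1 := hprod rk h (e d)
    have h2 := hprod r hr.isWeakSylvester (e d)
    have h3 : ∑ p ∈ P, (rk.elt 1 - rk.elt (p ^ e d p)) =
        ∑ p ∈ P, (r.elt 1 - r.elt (p ^ e d p)) :=
      Finset.sum_congr rfl fun p hp => by rw [hrp p hp _ (heJ d hd p), hr1]
    rw [h3, ← h2, hr1] at h1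
    linarith

/-- The ranks of finitely many matrices over `K[X]` are sums of ranks of finitely many diagonal
entries of Smith normal forms, so this reduces to ranks of single polynomials. -/
theorem isLocallyRepresentable_polynomial : IsLocallyRepresentable K K[X] := by
  classical
  intro rk h F
  choose k d hd using fun M : Σ m n : ℕ, Matrix (Fin m) (Fin n) K[X] =>
    IsWeakSylvester.exists_eq_sum_elt M.2.2
  obtain ⟨r, hr, hF⟩ := exists_repCone_elt_eq h (F.biUnion fun M => Finset.univ.image (d M))
  refine ⟨r, hr, fun M hM => ?_⟩
  rw [hd M rk h, hd M r hr.isWeakSylvester]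
  refine Finset.sum_congr rfl fun i _ => hF _ ?_
  exact Finset.mem_biUnion.mpr ⟨M, hM, Finset.mem_image_of_mem _ (Finset.mem_univ i)⟩

end polynomialRep

end polynomials

/-! ### Clopen towers for a homeomorphism -/

section towers

variable {X : Type u} [TopologicalSpace X]

/-- A finitely additive probability measure on the clopen sets of `X` that is invariant under `T`;
the values on other sets are irrelevant. -/
structure IsInvariantContent (T : X ≃ₜ X) (μ : Set X → ℝ) : Prop where
  nonneg : ∀ U, IsClopen U → 0 ≤ μ U
  union : ∀ U V, IsClopen U → IsClopen V → Disjoint U V → μ (U ∪ V) = μ U + μ V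
  preimage : ∀ U, IsClopen U → μ (T ⁻¹' U) = μ U
  univ : μ Set.univ = 1

theorem Homeomorph.zpow_add_apply (T : X ≃ₜ X) (m n : ℤ) (x : X) :
    (T ^ (m + n)) x = (T ^ m) ((T ^ n) x) := by
  rw [zpow_add, Homeomorph.mul_apply]

theorem Homeomorph.zpow_zero_apply (T : X ≃ₜ X) (x : X) : (T ^ (0 : ℤ)) x = x := by
  rw [zpow_zero, Homeomorph.one_apply]

theorem IsClopen.preimage_zpow {U : Set X} (hU : IsClopen U) (T : X ≃ₜ X) (n : ℤ) :
    IsClopen ((T ^ n) ⁻¹' U) :=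
  hU.preimage (T ^ n).continuous

namespace IsInvariantContent

variable {T : X ≃ₜ X} {μ : Set X → ℝ}

theorem empty (h : IsInvariantContent T μ) : μ ∅ = 0 := by
  have := h.union ∅ ∅ isClopen_empty isClopen_empty (by simp)
  simp only [Set.union_self] at this
  linarith

theorem mono (h : IsInvariantContent T μ) {U V : Set X} (hU : IsClopen U) (hV : IsClopen V)
    (hUV : U ⊆ V) : μ U ≤ μ V := by
  have h1 := h.union U (V \ U) hU (hV.diff hU) Set.disjoint_sdiff_right
  rw [Set.union_sdiff_cancel hUV] at h1
  linarith [h.nonneg _ (hV.diff hU)]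

theorem diff (h : IsInvariantContent T μ) {U V : Set X} (hU : IsClopen U) (hV : IsClopen V)
    (hUV : U ⊆ V) : μ (V \ U) = μ V - μ U := by
  have h1 := h.union U (V \ U) hU (hV.diff hU) Set.disjoint_sdiff_right
  rw [Set.union_sdiff_cancel hUV] at h1
  linarith

theorem biUnion (h : IsInvariantContent T μ) {ι : Type*} (s : Finset ι) (V : ι → Set X)
    (hV : ∀ i, IsClopen (V i)) (hd : ∀ i j, i ≠ j → Disjoint (V i) (V j)) :
    μ (⋃ i ∈ s, V i) = ∑ i ∈ s, μ (V i) := by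
  classical
  induction s using Finset.induction_on with
  | empty => simp [h.empty]
  | insert j s hj ih =>
    rw [Finset.set_biUnion_insert, Finset.sum_insert hj, ← ih]
    refine h.union _ _ (hV j) (isClopen_biUnion_finset fun i _ => hV i) ?_
    rw [Set.disjoint_iUnion₂_right]
    exact fun i hi => hd _ _ fun hji => hj (hji ▸ hi)

theorem biUnion_le (h : IsInvariantContent T μ) {ι : Type*} (s : Finset ι) (V : ι → Set X)
    (hV : ∀ i, IsClopen (V i)) : μ (⋃ i ∈ s, V i) ≤ ∑ i ∈ s, μ (V i) := by
  classical
  induction s using Finset.induction_on with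
  | empty => simp [h.empty]
  | insert j s hj ih =>
    rw [Finset.set_biUnion_insert, Finset.sum_insert hj]
    have hs : IsClopen (⋃ i ∈ s, V i) := isClopen_biUnion_finset fun i _ => hV i
    have h1 := h.union (V j) ((⋃ i ∈ s, V i) \ V j) (hV j) (hs.diff (hV j))
      Set.disjoint_sdiff_right
    rw [Set.union_sdiff_self] at h1
    have h2 := h.mono (hs.diff (hV j)) hs Set.sdiff_subset
    linarith

theorem preimage_zpow (h : IsInvariantContent T μ) {U : Set X} (hU : IsClopen U) (n : ℤ) :
    μ ((T ^ n) ⁻¹' U) = μ U := by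
  have hstep : ∀ n : ℤ, μ ((T ^ (n + 1)) ⁻¹' U) = μ ((T ^ n) ⁻¹' U) := fun n => by
    rw [← h.preimage _ (hU.preimage_zpow T n)]
    congr 1
    ext x
    simp [zpow_add_one]
  induction n using Int.induction_on with
  | zero => rfl
  | succ n ih => rw [hstep, ih]
  | pred n ih =>
    rw [← ih, ← hstep]
    simp

/-- Outer regularity: a set `Z` has a clopen neighbourhood `W` such that clopen subsets of
`W \ Z` have small measure. -/
theorem exists_clopen_superset (h : IsInvariantContent T μ) (Z : Set X) {δ : ℝ} (hδ : 0 < δ) :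
    ∃ W, IsClopen W ∧ Z ⊆ W ∧ ∀ B, IsClopen B → B ⊆ W → Disjoint B Z → μ B ≤ δ := by
  let S : Set ℝ := μ '' {W | IsClopen W ∧ Z ⊆ W}
  have hS : S.Nonempty := ⟨_, Set.univ, ⟨isClopen_univ, Set.subset_univ _⟩, rfl⟩
  have hb : BddBelow S := ⟨0, by
    rintro _ ⟨W, hW, rfl⟩
    exact h.nonneg _ hW.1⟩
  obtain ⟨_, ⟨W, ⟨hW, hZW⟩, rfl⟩, hlt⟩ :=
    exists_lt_of_csInf_lt hS (show sInf S < sInf S + δ by linarith)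
  refine ⟨W, hW, hZW, fun B hB hBW hBZ => ?_⟩
  have h1 : sInf S ≤ μ (W \ B) := csInf_le hb
    ⟨_, ⟨hW.diff hB, fun x hx => ⟨hZW hx, fun hxB => Set.disjoint_left.mp hBZ hxB hx⟩⟩, rfl⟩
  rw [h.diff hB hW hBW] at h1
  linarith

end IsInvariantContent

/-- Given clopen sets `U i`, there are clopen subsets `E i` whose translates by times smaller than
`N` still cover the union, and such that an orbit passing through different `E i` needs time at
least `N` in between. -/
theorem exists_markers (T : X ≃ₜ X) (N : ℕ) {ι : Type*} (U : ι → Set X) (hU : ∀ i, IsClopen (U i))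
    (hN : 0 < N) (s : Finset ι) :
    ∃ E : ι → Set X, (∀ i, IsClopen (E i)) ∧ (∀ i, E i ⊆ U i) ∧ (∀ i ∉ s, E i = ∅) ∧
      (∀ i ∈ s, ∀ x ∈ U i, ∃ j : ℤ, |j| < N ∧ ∃ i' ∈ s, (T ^ j) x ∈ E i') ∧
      ∀ i i' : ι, ∀ j : ℤ, |j| < N → ∀ x ∈ E i, (T ^ j) x ∈ E i' → i = i' := by
  classical
  induction s using Finset.induction_on with
  | empty =>
    exact ⟨fun _ => ∅, fun _ => isClopen_empty, fun _ => Set.empty_subset _, fun _ _ => rfl,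
      by simp, by simp⟩
  | insert a s ha ih =>
    obtain ⟨E, hE, hEU, hEs, hcov, hsep⟩ := ih
    let H : Set X := ⋃ j ∈ Finset.Ioo (-(N : ℤ)) N, ⋃ i ∈ s, (T ^ j) ⁻¹' (E i)
    have hH : IsClopen H := isClopen_biUnion_finset fun j _ =>
      isClopen_biUnion_finset fun i _ => (hE i).preimage_zpow T j
    have hmem : ∀ x, x ∈ H ↔ ∃ j : ℤ, |j| < N ∧ ∃ i ∈ s, (T ^ j) x ∈ E i := fun x => by
      simp [H, abs_lt]
    refine ⟨Function.update E a (U a \ H), fun i => ?_, fun i => ?_, fun i hi => ?_, ?_, ?_⟩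
    · by_cases hi : i = a
      · subst hi
        rw [Function.update_self]
        exact (hU i).diff hH
      · rw [Function.update_of_ne hi]
        exact hE i
    · by_cases hi : i = a
      · subst hi
        rw [Function.update_self]
        exact Set.sdiff_subset
      · rw [Function.update_of_ne hi]
        exact hEU i
    · rw [Finset.mem_insert, not_or] at hi
      rw [Function.update_of_ne hi.1]
      exact hEs i hi.2
    · have hlift : ∀ x, (∃ j : ℤ, |j| < N ∧ ∃ i ∈ s, (T ^ j) x ∈ E i) →
          ∃ j : ℤ, |j| < N ∧ ∃ i' ∈ insert a s,
            (T ^ j) x ∈ Function.update E a (U a \ H) i' := by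
        rintro x ⟨j, hj, i, hi, hx⟩
        refine ⟨j, hj, i, Finset.mem_insert_of_mem hi, ?_⟩
        have hia : i ≠ a := fun hia => ha (hia ▸ hi)
        rwa [Function.update_of_ne hia]
      intro i hi x hx
      rcases Finset.mem_insert.mp hi with rfl | hi
      · by_cases hxH : x ∈ H
        · exact hlift x ((hmem x).mp hxH)
        · refine ⟨0, by simpa using hN, i, hi, ?_⟩
          rw [Function.update_self, Homeomorph.zpow_zero_apply]
          exact ⟨hx, hxH⟩
      · exact hlift x (hcov i hi x hx)
    · have hout : ∀ i x, x ∈ E i → i ∈ s := fun i x hx => by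
        by_contra hi
        rw [hEs i hi] at hx
        exact hx
      intro i i' j hj x hx hx'
      by_cases hi : i = a <;> by_cases hi' : i' = a
      · rw [hi, hi']
      · subst hi
        rw [Function.update_self] at hx
        rw [Function.update_of_ne hi'] at hx'
        exact absurd ((hmem x).mpr ⟨j, hj, i', hout _ _ hx', hx'⟩) hx.2
      · subst hi'
        rw [Function.update_self] at hx'
        rw [Function.update_of_ne hi] at hx
        refine absurd ((hmem _).mpr ⟨-j, by rwa [abs_neg], i, hout _ _ hx, ?_⟩) hx'.2
        rwa [← Homeomorph.zpow_add_apply, neg_add_cancel, Homeomorph.zpow_zero_apply]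
      · rw [Function.update_of_ne hi] at hx
        rw [Function.update_of_ne hi'] at hx'
        exact hsep i i' j hj x hx hx'

/-- A point has a clopen neighbourhood disjoint from its translates up to time `N`, or up to the
period of the point if that is smaller. -/
theorem exists_clopen_period [CompactSpace X] [T2Space X] [TotallyDisconnectedSpace X]
    (T : X ≃ₜ X) {N : ℕ} (hN : 0 < N) (x : X) :
    ∃ (k : ℕ) (U : Set X), 0 < k ∧ k ≤ N ∧ (k < N → (T ^ (k : ℤ)) x = x) ∧ IsClopen U ∧ x ∈ U ∧
      ∀ j : ℕ, 0 < j → j < k → ∀ y ∈ U, (T ^ (j : ℤ)) y ∉ U := by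
  classical
  have hex : ∃ k : ℕ, 0 < k ∧ (k < N → (T ^ (k : ℤ)) x = x) :=
    ⟨N, hN, fun h => absurd h (lt_irrefl _)⟩
  let k := Nat.find hex
  have hk := Nat.find_spec hex
  have hkN : k ≤ N := Nat.find_min' hex ⟨hN, fun h => absurd h (lt_irrefl _)⟩
  have hmove : ∀ j : ℕ, 0 < j → j < k → (T ^ (j : ℤ)) x ≠ x := fun j hj hjk hx =>
    Nat.find_min hex hjk ⟨hj, fun _ => hx⟩
  have hsep : ∀ j : ℕ, ∃ A : Set X, IsClopen A ∧ x ∈ A ∧ (0 < j → j < k → (T ^ (j : ℤ)) x ∉ A) :=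
    fun j => by
      by_cases hj : 0 < j ∧ j < k
      · obtain ⟨A, hA, hxA, hxA'⟩ := exists_isClopen_of_totally_separated (hmove j hj.1 hj.2).symm
        exact ⟨A, hA, hxA, fun _ _ => hxA'⟩
      · exact ⟨Set.univ, isClopen_univ, Set.mem_univ _, fun h1 h2 => absurd ⟨h1, h2⟩ hj⟩
  choose A hA hxA hxA' using hsep
  let U : Set X := ⋂ j ∈ Finset.Ioo 0 k, A j ∩ (T ^ (j : ℤ)) ⁻¹' (A j)ᶜ
  refine ⟨k, U, hk.1, hkN, hk.2, ?_, ?_, ?_⟩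
  · exact isClopen_biInter_finset fun j _ => (hA j).inter ((hA j).compl.preimage_zpow T j)
  · simp only [U, Set.mem_iInter]
    intro j hj
    rw [Finset.mem_Ioo] at hj
    exact ⟨hxA j, hxA' j hj.1 hj.2⟩
  · intro j h0 hjk y hy hy'
    simp only [U, Set.mem_iInter] at hy hy'
    exact (hy j (Finset.mem_Ioo.mpr ⟨h0, hjk⟩)).2 (hy' j (Finset.mem_Ioo.mpr ⟨h0, hjk⟩)).1

/-- The levels of the towers over the sets `V i`, with heights `h i + 1`, form a partition. -/
structure IsTowerPartition (T : X ≃ₜ X) {ι : Type*} (V : ι → Set X) (h : ι → ℕ) : Prop where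
  isClopen : ∀ i, IsClopen (V i)
  exists_level : ∀ x, ∃ (i : ι) (a : ℕ), a ≤ h i ∧ (T ^ (-(a : ℤ))) x ∈ V i
  unique_level : ∀ (i j : ι) (a b : ℕ) (x : X), a ≤ h i → b ≤ h j → (T ^ (-(a : ℤ))) x ∈ V i →
    (T ^ (-(b : ℤ))) x ∈ V j → i = j ∧ a = b

/-- Towers of height at least `N` have bases of total measure at most `1 / N`. -/
theorem IsTowerPartition.mul_sum_le {T : X ≃ₜ X} {ι : Type*} {V : ι → Set X} {h : ι → ℕ}
    (hV : IsTowerPartition T V h) {μ : Set X → ℝ} (hμ : IsInvariantContent T μ) (N : ℕ)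
    (s : Finset ι) (hs : ∀ i ∈ s, N ≤ h i + 1) : N * ∑ i ∈ s, μ (V i) ≤ 1 := by
  classical
  let L : ι × ℕ → Set X := fun p =>
    if p.2 ≤ h p.1 then (T ^ (-(p.2 : ℤ))) ⁻¹' (V p.1) else ∅
  have hL : ∀ p, IsClopen (L p) := fun p => by
    simp only [L]
    split_ifs
    · exact (hV.isClopen _).preimage_zpow T _
    · exact isClopen_empty
  have hd : ∀ p q, p ≠ q → Disjoint (L p) (L q) := fun p q hpq => by
    rw [Set.disjoint_left]
    intro x hx hx'
    simp only [L] at hx hx'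
    split_ifs at hx hx' with h1 h2
    · obtain ⟨h3, h4⟩ := hV.unique_level _ _ _ _ x h1 h2 hx hx'
      exact hpq (Prod.ext h3 h4)
    all_goals simp_all
  have hsum := hμ.biUnion (s ×ˢ Finset.range N) L hL hd
  have hle := hμ.mono (isClopen_biUnion_finset (s := s ×ˢ Finset.range N) fun i _ => hL i)
    isClopen_univ (Set.subset_univ _)
  rw [hsum, hμ.univ, Finset.sum_product] at hle
  refine le_trans (le_of_eq ?_) hle
  rw [Finset.mul_sum]
  refine Finset.sum_congr rfl fun i hi => ?_
  have : ∀ a ∈ Finset.range N, μ (L (i, a)) = μ (V i) := fun a ha => by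
    have ha' : a ≤ h i := by
      have := hs i hi
      have := Finset.mem_range.mp ha
      omega
    simp only [L, if_pos ha']
    exact hμ.preimage_zpow (hV.isClopen i) _
  rw [Finset.sum_congr rfl this]
  simp

/-- Return times to a clopen set that every orbit hits with gaps at most `2 N` give a tower
partition; it can be refined so that a locally constant function is constant on the levels. -/
theorem exists_towers_of_recurrent [CompactSpace X] (T : X ≃ₜ X) (E : Set X) (hE : IsClopen E)
    (N : ℕ) (hcov : ∀ x, ∃ j : ℤ, |j| < N ∧ (T ^ j) x ∈ E) {Y : Type w} (c : X → Y)
    (hc : IsLocallyConstant c) :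
    ∃ (ι : Type w) (_ : Fintype ι) (V : ι → Set X) (h : ι → ℕ), IsTowerPartition T V h ∧
      (∀ i, (V i).Nonempty) ∧ (∀ i, V i ⊆ E) ∧
      (∀ i, ∀ x ∈ V i, (T ^ ((h i : ℤ) + 1)) x ∈ E) ∧
      (∀ i, ∀ x ∈ V i, ∀ b : ℕ, 0 < b → b ≤ h i → (T ^ (b : ℤ)) x ∉ E) ∧
      ∀ (i : ι) (a : ℕ), a ≤ h i → ∀ x ∈ V i, ∀ y ∈ V i,
        c ((T ^ (a : ℤ)) x) = c ((T ^ (a : ℤ)) y) := by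
  classical
  have hret : ∀ x, ∃ n : ℕ, n < 2 * N ∧ (T ^ ((n : ℤ) + 1)) x ∈ E := fun x => by
    obtain ⟨j, hj, hjE⟩ := hcov ((T ^ (N : ℤ)) x)
    rw [← Homeomorph.zpow_add_apply] at hjE
    have := abs_lt.mp hj
    refine ⟨(j + N - 1).toNat, by omega, ?_⟩
    have h1 : (((j + N - 1).toNat : ℕ) : ℤ) + 1 = j + N := by omega
    rwa [h1]
  have hret' : ∀ x, ∃ n : ℕ, (T ^ ((n : ℤ) + 1)) x ∈ E := fun x =>
    (hret x).imp fun n hn => hn.2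
  let ρ : X → ℕ := fun x => Nat.find (hret' x)
  have hρ : ∀ x, (T ^ ((ρ x : ℤ) + 1)) x ∈ E := fun x => Nat.find_spec (hret' x)
  have hρmin : ∀ x (n : ℕ), (T ^ ((n : ℤ) + 1)) x ∈ E → ρ x ≤ n := fun x n hn =>
    Nat.find_min' (hret' x) hn
  have hρlt : ∀ x, ρ x < 2 * N := fun x => by
    obtain ⟨n, hn, hnE⟩ := hret x
    exact (hρmin x n hnE).trans_lt hn
  let code : X → ℕ × (Fin (2 * N) → Y) := fun x => (ρ x, fun a => c ((T ^ ((a : ℕ) : ℤ)) x))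
  have hcode : IsLocallyConstant code := by
    rw [IsLocallyConstant.iff_eventually_eq]
    intro x
    have h1 : ∀ᶠ y in nhds x, ∀ n : Fin (2 * N),
        ((T ^ (((n : ℕ) : ℤ) + 1)) y ∈ E ↔ (T ^ (((n : ℕ) : ℤ) + 1)) x ∈ E) := by
      rw [Filter.eventually_all]
      intro n
      have hcl := hE.preimage_zpow T (((n : ℕ) : ℤ) + 1)
      by_cases hx : (T ^ (((n : ℕ) : ℤ) + 1)) x ∈ E
      · filter_upwards [hcl.isOpen.mem_nhds hx] with y hy
        exact iff_of_true hy hx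
      · filter_upwards [hcl.compl.isOpen.mem_nhds hx] with y hy
        exact iff_of_false hy hx
    have h2 : ∀ᶠ y in nhds x, ∀ a : Fin (2 * N),
        c ((T ^ ((a : ℕ) : ℤ)) y) = c ((T ^ ((a : ℕ) : ℤ)) x) := by
      rw [Filter.eventually_all]
      intro a
      exact (T ^ ((a : ℕ) : ℤ)).continuous.continuousAt.eventually (hc.eventually_eq _)
    filter_upwards [h1, h2] with y hy1 hy2
    refine Prod.ext (le_antisymm ?_ ?_) (funext hy2)
    · exact hρmin y _ ((hy1 ⟨ρ x, hρlt x⟩).mpr (hρ x))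
    · exact hρmin x _ ((hy1 ⟨ρ y, hρlt y⟩).mp (hρ y))
  have hfin : (code '' E).Finite := hcode.range_finite.subset (Set.image_subset_range _ _)
  let ι : Type w := (code '' E : Set (ℕ × (Fin (2 * N) → Y)))
  let V : ι → Set X := fun i => E ∩ {x | code x = i.1}
  have hVE : ∀ i, V i ⊆ E := fun i => Set.inter_subset_left
  have hVρ : ∀ i, ∀ x ∈ V i, ρ x = i.1.1 := fun i x hx => congrArg Prod.fst hx.2
  have hfirst : ∀ i, ∀ x ∈ V i, ∀ b : ℕ, 0 < b → b ≤ i.1.1 → (T ^ (b : ℤ)) x ∉ E := by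
    intro i x hx b hb hbi hbE
    have h1 : (((b - 1 : ℕ) : ℕ) : ℤ) + 1 = b := by omega
    have h2 := hρmin x (b - 1) (by rwa [h1])
    rw [hVρ i x hx] at h2
    omega
  refine ⟨ι, hfin.fintype, V, fun i => i.1.1, ⟨fun i => ?_, fun x => ?_, ?_⟩, ?_, hVE, ?_, hfirst,
    ?_⟩
  · exact hE.inter (hcode.isClopen_fiber _)
  · -- go back to the last visit to `E`
    have hback : ∃ a : ℕ, (T ^ (-(a : ℤ))) x ∈ E := by
      obtain ⟨j, hj, hjE⟩ := hcov ((T ^ (-(N : ℤ))) x)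
      rw [← Homeomorph.zpow_add_apply] at hjE
      have := abs_lt.mp hj
      refine ⟨(N - j).toNat, ?_⟩
      have h1 : -(((N - j).toNat : ℕ) : ℤ) = j + -N := by omega
      rwa [h1]
    let a := Nat.find hback
    have ha : (T ^ (-(a : ℤ))) x ∈ E := Nat.find_spec hback
    let y := (T ^ (-(a : ℤ))) x
    refine ⟨⟨code y, y, ha, rfl⟩, a, ?_, ha, rfl⟩
    change a ≤ ρ y
    by_contra hlt
    rw [not_le] at hlt
    have h1 := hρ y
    simp only [y] at h1
    rw [← Homeomorph.zpow_add_apply] at h1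
    refine Nat.find_min hback (m := a - (ρ y + 1)) (by omega) ?_
    have h2 : (-((a - (ρ y + 1) : ℕ) : ℤ)) = (ρ y : ℤ) + 1 + -(a : ℤ) := by omega
    rwa [h2]
  · have key : ∀ (i j : ι) (a b : ℕ) (x : X), a ≤ i.1.1 → b ≤ j.1.1 →
        (T ^ (-(a : ℤ))) x ∈ V i → (T ^ (-(b : ℤ))) x ∈ V j → b ≤ a := by
      intro i j a b x ha hb hx hx'
      by_contra hab
      refine hfirst j _ hx' (b - a) (by omega) (by omega) ?_
      rw [← Homeomorph.zpow_add_apply]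
      have h1 : ((b - a : ℕ) : ℤ) + -(b : ℤ) = -(a : ℤ) := by omega
      rw [h1]
      exact hVE i hx
    intro i j a b x ha hb hx hx'
    have hab : a = b := le_antisymm (key j i b a x hb ha hx' hx) (key i j a b x ha hb hx hx')
    subst hab
    exact ⟨Subtype.ext (hx.2.symm.trans hx'.2), rfl⟩
  · rintro ⟨_, x, hx, rfl⟩
    exact ⟨x, hx, rfl⟩
  · intro i x hx
    have h1 := hρ x
    rwa [hVρ i x hx] at h1
  · intro i a ha x hx y hy
    have h1 : a < 2 * N := ha.trans_lt ((hVρ i x hx).symm.trans_lt (hρlt x))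
    have h2 := congrArg Prod.snd (hx.2.trans hy.2.symm)
    exact congrFun h2 ⟨a, h1⟩

/-- Periodic approximation: there are clopen towers partitioning `X`, on whose levels a given
locally constant function is constant, such that the points of the top levels that do not return to
the base of their own tower have small measure. -/
theorem exists_towers [CompactSpace X] [T2Space X] [TotallyDisconnectedSpace X] (T : X ≃ₜ X)
    {μ : Set X → ℝ} (hμ : IsInvariantContent T μ) {Y : Type w} (c : X → Y)
    (hc : IsLocallyConstant c) {ε : ℝ} (hε : 0 < ε) :
    ∃ (ι : Type w) (_ : Fintype ι) (V : ι → Set X) (h : ι → ℕ), IsTowerPartition T V h ∧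
      (∀ i, (V i).Nonempty) ∧
      (∀ (i : ι) (a : ℕ), a ≤ h i → ∀ x ∈ V i, ∀ y ∈ V i,
        c ((T ^ (a : ℤ)) x) = c ((T ^ (a : ℤ)) y)) ∧
      ∑ i, μ ((T ^ (-((h i : ℤ) + 1))) ⁻¹' (V i) \ V i) ≤ ε := by
  classical
  obtain ⟨N, hNε⟩ := exists_nat_gt (2 / ε)
  have hN0 : (0 : ℝ) < N := lt_trans (by positivity) hNε
  have hN : 0 < N := by exact_mod_cast hN0
  have hNε' : 1 / (N : ℝ) ≤ ε / 2 := by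
    rw [div_le_div_iff₀ hN0 two_pos]
    rw [div_lt_iff₀ hε] at hNε
    linarith
  -- around a periodic point of small period, work inside a clopen set that contains all points of
  -- this period and little else
  let Per : ℕ → Set X := fun k => {x | (T ^ (k : ℤ)) x = x}
  choose W hW hPW hWsmall using fun k : ℕ =>
    hμ.exists_clopen_superset (Per k) (show 0 < ε / 2 / N by positivity)
  choose k U₀ hk0 hkN hkper hU₀ hxU₀ hU₀disj using exists_clopen_period T hN
  let U : X → Set X := fun x => if k x < N then U₀ x ∩ W (k x) else U₀ x
  have hUU₀ : ∀ x, U x ⊆ U₀ x := fun x => by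
    simp only [U]
    split_ifs
    · exact Set.inter_subset_left
    · exact subset_rfl
  have hU : ∀ x, IsClopen (U x) := fun x => by
    simp only [U]
    split_ifs
    · exact (hU₀ x).inter (hW _)
    · exact hU₀ x
  have hxU : ∀ x, x ∈ U x := fun x => by
    simp only [U]
    split_ifs with hlt
    · exact ⟨hxU₀ x, hPW _ (hkper x hlt)⟩
    · exact hxU₀ x
  have hUW : ∀ x, k x < N → U x ⊆ W (k x) := fun x hlt => by
    simp only [U, if_pos hlt]
    exact Set.inter_subset_right
  obtain ⟨t, ht⟩ := CompactSpace.elim_nhds_subcover U fun x => (hU x).isOpen.mem_nhds (hxU x)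
  obtain ⟨E, hE, hEU, hEt, hcov, hsep⟩ := exists_markers T N U hU hN t
  let E' : Set X := ⋃ p ∈ t, E p
  have hE' : IsClopen E' := isClopen_biUnion_finset fun p _ => hE p
  have hmemE' : ∀ x, x ∈ E' ↔ ∃ p ∈ t, x ∈ E p := fun x => by simp [E']
  have hcov' : ∀ x, ∃ j : ℤ, |j| < N ∧ (T ^ j) x ∈ E' := fun x => by
    have hx : x ∈ ⋃ p ∈ t, U p := ht ▸ Set.mem_univ x
    simp only [Set.mem_iUnion] at hx
    obtain ⟨p, hp, hxp⟩ := hx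
    obtain ⟨j, hj, i', hi', hmem⟩ := hcov p hp x hxp
    exact ⟨j, hj, (hmemE' _).mpr ⟨i', hi', hmem⟩⟩
  obtain ⟨ι, _, V, h, hV, hVne, hVE, hVret, hVfirst, hVc⟩ :=
    exists_towers_of_recurrent T E' hE' N hcov' c hc
  refine ⟨ι, inferInstance, V, h, hV, hVne, hVc, ?_⟩
  rw [← Finset.sum_filter_add_sum_filter_not Finset.univ fun i => N ≤ h i + 1]
  -- towers of height at least `N`: their exits are no larger than their bases
  have htall : ∑ i ∈ Finset.univ.filter (fun i => N ≤ h i + 1),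
      μ ((T ^ (-((h i : ℤ) + 1))) ⁻¹' (V i) \ V i) ≤ ε / 2 := by
    refine le_trans (Finset.sum_le_sum (g := fun i => μ (V i)) fun i _ => ?_) ?_
    · rw [← hμ.preimage_zpow (hV.isClopen i) (-((h i : ℤ) + 1))]
      exact hμ.mono (((hV.isClopen i).preimage_zpow T _).diff (hV.isClopen i))
        ((hV.isClopen i).preimage_zpow T _) Set.sdiff_subset
    · have h1 := hV.mul_sum_le hμ N (Finset.univ.filter fun i => N ≤ h i + 1)
        fun i hi => (Finset.mem_filter.mp hi).2
      refine le_trans ?_ hNε'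
      rw [le_div_iff₀ hN0, mul_comm]
      exact h1
  -- short towers: the exits from the base avoid the periodic points
  let B : ι → Set X := fun i => V i \ (T ^ ((h i : ℤ) + 1)) ⁻¹' (V i)
  have hB : ∀ i, IsClopen (B i) := fun i =>
    (hV.isClopen i).diff ((hV.isClopen i).preimage_zpow T _)
  have hVdisj : ∀ i j, i ≠ j → Disjoint (V i) (V j) := fun i j hij => by
    rw [Set.disjoint_left]
    intro x hx hx'
    refine hij (hV.unique_level i j 0 0 x (Nat.zero_le _) (Nat.zero_le _) ?_ ?_).1
    · simpa using hx
    · simpa using hx'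
  have hexit : ∀ i, μ ((T ^ (-((h i : ℤ) + 1))) ⁻¹' (V i) \ V i) = μ (B i) := fun i => by
    rw [← hμ.preimage_zpow (hB i) (-((h i : ℤ) + 1))]
    congr 1
    ext x
    simp only [B, Set.mem_sdiff, Set.mem_preimage]
    rw [← Homeomorph.zpow_add_apply, add_neg_cancel, Homeomorph.zpow_zero_apply]
  set s := Finset.univ.filter (fun i => ¬ N ≤ h i + 1)
  let Z : ℕ → Set X := fun m => (⋃ i ∈ s, B i) ∩ ⋃ p ∈ t.filter (fun p => k p = m), E p
  have hBcl : IsClopen (⋃ i ∈ s, B i) := isClopen_biUnion_finset fun i _ => hB i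
  have hZ : ∀ m, IsClopen (Z m) := fun m =>
    hBcl.inter (isClopen_biUnion_finset fun p _ => hE p)
  -- an exit point of a short tower lies in a marker piece of small period, and is not periodic
  have hkey : ∀ i ∈ s, ∀ x ∈ B i, ∀ p ∈ t, x ∈ E p → k p < N ∧ x ∉ Per (k p) := by
    intro i hi x hx p hp hxp
    have hiN : h i + 1 < N := not_le.mp (Finset.mem_filter.mp hi).2
    obtain ⟨p', hp', hxp'⟩ := (hmemE' _).mp (hVret i x hx.1)
    have hpp' : p = p' := hsep p p' _ (by rw [abs_of_nonneg (by omega)]; omega) x hxp hxp'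
    subst hpp'
    have hkle : k p ≤ h i + 1 := by
      by_contra hlt
      refine hU₀disj p (h i + 1) (Nat.succ_pos _) (by omega) x (hUU₀ p (hEU p hxp)) ?_
      push_cast
      exact hUU₀ p (hEU p hxp')
    refine ⟨by omega, fun hper => ?_⟩
    have hper' : (T ^ (k p : ℤ)) x = x := hper
    have hxE : x ∈ E' := hVE i hx.1
    rcases Nat.lt_or_ge (h i) (k p) with hlt | hge
    · have : k p = h i + 1 := by omega
      refine hx.2 ?_
      rw [this] at hper'
      push_cast at hper'
      rw [Set.mem_preimage, hper']
      exact hx.1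
    · refine hVfirst i x hx.1 (k p) (hk0 p) hge ?_
      rw [hper']
      exact hxE
  have hcovB : (⋃ i ∈ s, B i) ⊆ ⋃ m ∈ Finset.range N, Z m := by
    intro x hx
    have hx' := hx
    simp only [Set.mem_iUnion] at hx
    obtain ⟨i, hi, hxi⟩ := hx
    obtain ⟨p, hp, hxp⟩ := (hmemE' _).mp (hVE i hxi.1)
    simp only [Set.mem_iUnion]
    refine ⟨k p, Finset.mem_range.mpr (hkey i hi x hxi p hp hxp).1, hx', ?_⟩
    simp only [Set.mem_iUnion]
    exact ⟨p, Finset.mem_filter.mpr ⟨hp, rfl⟩, hxp⟩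
  have hZsmall : ∀ m ∈ Finset.range N, μ (Z m) ≤ ε / 2 / N := by
    intro m hm
    rw [Finset.mem_range] at hm
    refine hWsmall m (Z m) (hZ m) ?_ ?_
    · rintro x ⟨-, hx⟩
      simp only [Set.mem_iUnion] at hx
      obtain ⟨p, hp, hxp⟩ := hx
      have hpm := (Finset.mem_filter.mp hp).2
      rw [← hpm]
      exact hUW p (by omega) (hEU p hxp)
    · rw [Set.disjoint_left]
      rintro x ⟨hxB, hx⟩ hxper
      simp only [Set.mem_iUnion] at hx hxB
      obtain ⟨p, hp, hxp⟩ := hx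
      obtain ⟨i, hi, hxi⟩ := hxB
      obtain ⟨hpt, hpm⟩ := Finset.mem_filter.mp hp
      rw [← hpm] at hxper
      exact (hkey i hi x hxi p hpt hxp).2 hxper
  have hshort : ∑ i ∈ s, μ ((T ^ (-((h i : ℤ) + 1))) ⁻¹' (V i) \ V i) ≤ ε / 2 := by
    rw [Finset.sum_congr rfl fun i _ => hexit i, ← hμ.biUnion s B hB fun i j hij =>
      (hVdisj i j hij).mono Set.sdiff_subset Set.sdiff_subset]
    refine (hμ.mono hBcl (isClopen_biUnion_finset fun m _ => hZ m) hcovB).trans ?_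
    refine (hμ.biUnion_le _ Z hZ).trans ((Finset.sum_le_sum hZsmall).trans_eq ?_)
    rw [Finset.sum_const, Finset.card_range, nsmul_eq_mul]
    field_simp
  linarith

end towers

/-! ### Matrix units and covariant pairs -/

section matrixUnitsAndHomeo

open Polynomial

section matrixUnits

variable {R : Type u} [Ring R] {D : Type v} [Ring D] {ι : Type*} [Fintype ι] {h : ι → ℕ}

/-- Matrix units `s i a * r i b` over corners `e i = η i 1` of `R`, given by non-unital
homomorphisms `η i` from `D`. -/
structure IsTowerSystem (η : ι → D →ₙ+* R) (s r : ∀ i, Fin (h i + 1) → R) : Prop where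
  mul_self : ∀ i a, r i a * s i a = η i 1
  mul_of_ne : ∀ i a b, a ≠ b → r i a * s i b = 0
  mul_of_ne' : ∀ i j a b, i ≠ j → r i a * s j b = 0
  corner_mul : ∀ i a, η i 1 * r i a = r i a
  sum_eq_one : ∑ i, ∑ a, s i a * r i a = 1

variable {η : ι → D →ₙ+* R} {s r : ∀ i, Fin (h i + 1) → R}

theorem IsTowerSystem.mul_sum (H : IsTowerSystem η s r) (i : ι) (b : Fin (h i + 1))
    (N : ∀ i, Matrix (Fin (h i + 1)) (Fin (h i + 1)) D) :
    r i b * ∑ j, ∑ c, ∑ d, s j c * η j (N j c d) * r j d = ∑ d, η i (N i b d) * r i d := by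
  classical
  rw [Finset.mul_sum, Finset.sum_eq_single i]
  · rw [Finset.mul_sum, Finset.sum_eq_single b]
    · rw [Finset.mul_sum]
      refine Finset.sum_congr rfl fun d _ => ?_
      rw [← mul_assoc, ← mul_assoc, H.mul_self, ← map_mul, one_mul]
    · intro c _ hc
      rw [Finset.mul_sum]
      refine Finset.sum_eq_zero fun d _ => ?_
      rw [← mul_assoc, ← mul_assoc, H.mul_of_ne i b c hc.symm, zero_mul, zero_mul]
    · simp
  · intro j _ hj
    rw [Finset.mul_sum]
    refine Finset.sum_eq_zero fun c _ => ?_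
    rw [Finset.mul_sum]
    refine Finset.sum_eq_zero fun d _ => ?_
    rw [← mul_assoc, ← mul_assoc, H.mul_of_ne' i j b c hj.symm, zero_mul, zero_mul]
  · simp

/-- The homomorphism from a product of matrix rings defined by a system of matrix units. -/
def IsTowerSystem.hom (H : IsTowerSystem η s r) :
    (∀ i, Matrix (Fin (h i + 1)) (Fin (h i + 1)) D) →+* R where
  toFun N := ∑ i, ∑ a, ∑ b, s i a * η i (N i a b) * r i b
  map_zero' := by simp
  map_one' := by
    rw [← H.sum_eq_one]
    refine Finset.sum_congr rfl fun i _ => Finset.sum_congr rfl fun a _ => ?_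
    rw [Finset.sum_eq_single a]
    · rw [Pi.one_apply, Matrix.one_apply_eq, mul_assoc, H.corner_mul]
    · intro b _ hb
      rw [Pi.one_apply, Matrix.one_apply_ne hb.symm, map_zero, mul_zero, zero_mul]
    · simp
  map_add' M N := by
    simp only [Pi.add_apply, Matrix.add_apply, map_add, mul_add, add_mul, Finset.sum_add_distrib]
  map_mul' M N := by
    rw [Finset.sum_mul]
    refine Finset.sum_congr rfl fun i _ => ?_
    rw [Finset.sum_mul]
    refine Finset.sum_congr rfl fun a _ => ?_
    simp only [Finset.sum_mul, mul_assoc]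
    simp only [← mul_assoc _ _ (∑ j, _)]
    have : ∀ b, s i a * (η i (M i a b) * (r i b * ∑ j, ∑ c, ∑ d, s j c * (η j (N j c d) * r j d))) =
        ∑ d, s i a * (η i (M i a b * N i b d) * r i d) := fun b => by
      have h1 := H.mul_sum i b N
      simp only [mul_assoc] at h1
      rw [h1, Finset.mul_sum, Finset.mul_sum]
      refine Finset.sum_congr rfl fun d _ => ?_
      rw [map_mul, mul_assoc]
    simp only [mul_assoc, this]
    rw [Finset.sum_comm]
    refine Finset.sum_congr rfl fun d _ => ?_
    rw [← Finset.mul_sum, ← Finset.sum_mul, ← map_sum, Pi.mul_apply, Matrix.mul_apply]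

theorem IsTowerSystem.hom_apply (H : IsTowerSystem η s r)
    (N : ∀ i, Matrix (Fin (h i + 1)) (Fin (h i + 1)) D) :
    H.hom N = ∑ i, ∑ a, ∑ b, s i a * η i (N i a b) * r i b := rfl

/-- The shift along a tower, closed up by the variable `X`: the basis vector of a level goes to the
one of the next level, and that of the top level goes to `X` times that of the base. -/
noncomputable def towerShift {K : Type v} [Field K] (n : ℕ) :
    Matrix (Fin (n + 1)) (Fin (n + 1)) K[X] :=
  Matrix.of fun a b => Fin.lastCases (motive := fun _ => K[X]) (if a = 0 then X else 0)
    (fun b' => if a = b'.succ then 1 else 0) b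

end matrixUnits

section cornerEval

variable {K : Type v} [Field K] {R : Type u} [Ring R]

theorem commute_eval₂ (κ : K →+* R) (u e : R) (hκu : ∀ c, Commute (κ c) u)
    (hκe : ∀ c, Commute (κ c) e) (hue : Commute e u) (p : K[X]) :
    Commute e (eval₂RingHom' κ u hκu p) := by
  induction p using Polynomial.induction_on' with
  | add p q hp hq =>
    rw [map_add]
    exact hp.add_right hq
  | monomial n c =>
    have : eval₂RingHom' κ u hκu (monomial n c) = κ c * u ^ n := eval₂_monomial _ _
    rw [this]
    exact (hκe c).symm.mul_right (hue.pow_right n)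

/-- Evaluation of polynomials at `u`, followed by multiplication with a commuting idempotent. -/
noncomputable def cornerEval (κ : K →+* R) (u e : R) (hκu : ∀ c, Commute (κ c) u)
    (hκe : ∀ c, Commute (κ c) e) (hue : Commute e u) (he : IsIdempotentElem e) : K[X] →ₙ+* R where
  toFun p := e * eval₂RingHom' κ u hκu p
  map_zero' := by simp
  map_add' p q := by rw [map_add, mul_add]
  map_mul' p q := by
    have h1 := (commute_eval₂ κ u e hκu hκe hue p).eq
    calc e * eval₂RingHom' κ u hκu (p * q)
        = (e * e) * (eval₂RingHom' κ u hκu p * eval₂RingHom' κ u hκu q) := by rw [he.eq, map_mul]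
      _ = e * (e * eval₂RingHom' κ u hκu p) * eval₂RingHom' κ u hκu q := by
          simp only [mul_assoc]
      _ = e * eval₂RingHom' κ u hκu p * (e * eval₂RingHom' κ u hκu q) := by
          rw [← mul_assoc (e * eval₂RingHom' κ u hκu p) e, mul_assoc e _ e, ← h1]

end cornerEval

/-- If conjugation by `u` implements an automorphism, then powers of `u` implement its powers. -/
theorem Units.zpow_mul_of_conj {A : Type a} {R : Type w} [Ring A] [Ring R] {α : RingAut A}
    (f : A →+* R) (u : Rˣ) (H : ∀ b, (u : R) * f b = f (α b) * u) (n : ℤ) (b : A) :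
    ((u ^ n : Rˣ) : R) * f b = f ((α ^ n) b) * ((u ^ n : Rˣ) : R) := by
  induction n using Int.induction_on generalizing b with
  | zero => simp
  | succ n ih =>
    rw [zpow_add_one, zpow_add_one, Units.val_mul, mul_assoc, H b, ← mul_assoc, ih, mul_assoc]
    rfl
  | pred n ih =>
    have h1 : ((u⁻¹ : Rˣ) : R) * f b = f (α⁻¹ b) * ((u⁻¹ : Rˣ) : R) := by
      rw [Units.inv_mul_eq_iff_eq_mul, ← mul_assoc, H, ← RingAut.mul_apply, mul_inv_cancel,
        mul_assoc, Units.mul_inv, mul_one]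
      rfl
    rw [zpow_sub_one, zpow_sub_one, Units.val_mul, mul_assoc, h1, ← mul_assoc, ih, mul_assoc]
    rfl

section homeo

variable {X : Type u} [TopologicalSpace X] {K : Type v} [Field K]

theorem homeoAut_zpow_apply (T : X ≃ₜ X) (n : ℤ) (b : LocallyConstant X K) (x : X) :
    ((homeoAut K T) ^ n) b x = b ((T ^ (-n)) x) := by
  have h1 : ∀ (b : LocallyConstant X K) (x : X), homeoAut K T b x = b (T.symm x) :=
    fun b x => rfl
  have h2 : ∀ (b : LocallyConstant X K) (x : X), (homeoAut K T)⁻¹ b x = b (T x) :=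
    fun b x => rfl
  induction n using Int.induction_on generalizing x with
  | zero => simp
  | succ n ih =>
    rw [add_comm, zpow_add, zpow_one, RingAut.mul_apply, h1, ih, neg_add, add_comm,
      Homeomorph.zpow_add_apply]
    simp
  | pred n ih =>
    rw [sub_eq_neg_add, zpow_add, zpow_neg_one, RingAut.mul_apply, h2, ih, neg_add, add_comm,
      Homeomorph.zpow_add_apply]
    simp

/-- The unit `t` of `R` implements the homeomorphism `T` on the image of the locally constant
functions. -/
def Implements {R : Type w} [Ring R] (T : X ≃ₜ X) (ι : LocallyConstant X K →+* R) (t : Rˣ) : Prop :=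
  ∀ b, (t : R) * ι b = ι (homeoAut K T b) * t

variable {R : Type w} [Ring R] {T : X ≃ₜ X} {ι : LocallyConstant X K →+* R} {t : Rˣ}

theorem Implements.zpow (H : Implements T ι t) (n : ℤ) (b : LocallyConstant X K) :
    ((t ^ n : Rˣ) : R) * ι b = ι ((homeoAut K T ^ n) b) * ((t ^ n : Rˣ) : R) :=
  Units.zpow_mul_of_conj ι t H n b

/-- A Sylvester rank function induces an invariant content on the clopen sets, the rank of the
characteristic function. -/
theorem Implements.exists_content (H : Implements T ι t) {rk : MatrixFunction R}
    (h : IsWeakSylvester rk) (h1 : rk.elt 1 = 1) : ∃ μ : Set X → ℝ, IsInvariantContent T μ ∧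
      ∀ U (hU : IsClopen U), μ U = rk.elt (ι (LocallyConstant.charFn K hU)) := by
  classical
  let μ : Set X → ℝ := fun U =>
    if hU : IsClopen U then rk.elt (ι (LocallyConstant.charFn K hU)) else 0
  have hμ : ∀ U (hU : IsClopen U), μ U = rk.elt (ι (LocallyConstant.charFn K hU)) :=
    fun U hU => dif_pos hU
  refine ⟨μ, ⟨fun U hU => ?_, fun U V hU hV hUV => ?_, fun U hU => ?_, ?_⟩, hμ⟩
  · rw [hμ U hU]
    exact h.elt_nonneg _
  · rw [hμ U hU, hμ V hV, hμ _ (hU.union hV), ← h.elt_add_of_orthogonal, ← map_add]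
    · congr 2
      ext x
      simp only [LocallyConstant.coe_charFn, LocallyConstant.coe_add, Pi.add_apply,
        Set.indicator_union_of_disjoint hUV]
    all_goals
      rw [Set.disjoint_left] at hUV
      try rw [IsIdempotentElem]
      rw [← map_mul]
      first | rw [← map_zero ι] | skip
      congr 1
      ext x
      by_cases hxU : x ∈ U <;> by_cases hxV : x ∈ V <;>
        simp_all [LocallyConstant.coe_charFn]
  · rw [hμ U hU, hμ _ (hU.preimage T.continuous)]
    have h2 : homeoAut K T (LocallyConstant.charFn K (hU.preimage T.continuous)) =
        LocallyConstant.charFn K hU := by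
      ext x
      change LocallyConstant.charFn K (hU.preimage T.continuous) (T.symm x) = _
      simp only [LocallyConstant.coe_charFn]
      by_cases hx : x ∈ U <;> simp [hx]
    have h3 := H (LocallyConstant.charFn K (hU.preimage T.continuous))
    rw [h2] at h3
    refine le_antisymm ?_ ?_
    · rw [← Units.eq_inv_mul_iff_mul_eq] at h3
      rw [h3]
      exact (h.elt_mul_le_right _ _).trans (h.elt_mul_le_left _ _)
    · rw [← Units.mul_inv_eq_iff_eq_mul] at h3
      rw [← h3]
      exact (h.elt_mul_le_left _ _).trans (h.elt_mul_le_right _ _)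
  · rw [hμ _ isClopen_univ, ← h1]
    congr 1
    rw [← map_one ι]
    congr 1
    ext x
    simp [LocallyConstant.coe_charFn]

end homeo

end matrixUnitsAndHomeo

/-! ### Approximation by matrix rings over a polynomial ring -/

section towerApproximation

open Polynomial

section approximation

variable {X : Type u} [TopologicalSpace X] {K : Type v} [Field K] {R : Type w} [Ring R]
  {T : X ≃ₜ X} {ι : LocallyConstant X K →+* R} {t : Rˣ}

/-- The ring generated by the locally constant functions and `t` is approximated in rank by
homomorphic images of finite products of matrix rings over `K[X]`. -/
theorem Implements.exists_approx [CompactSpace X] [T2Space X] [TotallyDisconnectedSpace X]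
    (H : Implements T ι t) {rk : MatrixFunction R} (hrk : IsWeakSylvester rk) (h1 : rk.elt 1 = 1)
    (F : Finset (LocallyConstant X K)) {ε : ℝ} (hε : 0 < ε) :
    ∃ (S : Type max u v) (_ : Ring S) (ψ : S →+* R) (ρ : LocallyConstant X K →+* S) (τ : S),
      IsLocallyRepresentable K S ∧ (∀ b ∈ F, ψ (ρ b) = ι b) ∧ rk.elt (t - ψ τ) ≤ ε := by
  classical
  obtain ⟨μ, hμ, hμrk⟩ := H.exists_content hrk h1
  have hc : IsLocallyConstant fun (x : X) (f : F) => (f : LocallyConstant X K) x := by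
    rw [IsLocallyConstant.iff_eventually_eq]
    intro x
    have : ∀ᶠ y in nhds x, ∀ f : F, (f : LocallyConstant X K) y = (f : LocallyConstant X K) x :=
      Filter.eventually_all.mpr fun f => (f : LocallyConstant X K).isLocallyConstant.eventually_eq x
    filter_upwards [this] with y hy
    exact funext hy
  -- towers on whose levels all the functions in `F` are constant
  obtain ⟨J, _, V, h, hV, hVne, hVc, hsum⟩ := exists_towers T hμ _ hc hε
  choose x₀ hx₀ using hVne
  let α : RingAut (LocallyConstant X K) := homeoAut K T
  have hα : ∀ (n : ℤ) (b : LocallyConstant X K) (x : X), (α ^ n) b x = b ((T ^ (-n)) x) :=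
    homeoAut_zpow_apply T
  let u : ℤ → R := fun n => ((t ^ n : Rˣ) : R)
  have hu : ∀ m n, u m * u n = u (m + n) := fun m n => by
    simp only [u]
    rw [zpow_add, Units.val_mul]
  have hu0 : u 0 = 1 := by simp [u]
  have huι : ∀ (n : ℤ) b, u n * ι b = ι ((α ^ n) b) * u n := fun n b => H.zpow n b
  let χ : J → LocallyConstant X K := fun i => LocallyConstant.charFn K (hV.isClopen i)
  have hχ : ∀ i x, χ i x = if x ∈ V i then 1 else 0 := fun i x => by
    simp only [χ, LocallyConstant.coe_charFn, Set.indicator_apply, Pi.one_apply]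
  have hχχ : ∀ i, χ i * χ i = χ i := fun i => by
    ext x
    rw [LocallyConstant.mul_apply, hχ]
    split_ifs <;> simp
  let e : J → R := fun i => ι (χ i)
  have he : ∀ i, e i * e i = e i := fun i => by
    simp only [e]
    rw [← map_mul, hχχ]
  let κ : K →+* R := ι.comp LocallyConstant.constRingHom
  have hκι : ∀ c b, Commute (κ c) (ι b) := fun c b => by
    change ι _ * ι b = ι b * ι _
    rw [← map_mul, ← map_mul, mul_comm]
  have hκu : ∀ c n, Commute (κ c) (u n) := fun c n => by
    change ι _ * u n = u n * ι _
    rw [huι]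
    congr 2
    ext x
    rw [hα]
    rfl
  -- the first return to the base of the tower, cut down to the base
  let g : J → R := fun i => e i * u ((h i : ℤ) + 1) * e i
  have heg : ∀ i, e i * g i = g i := fun i => by simp only [g, ← mul_assoc, he]
  have hge : ∀ i, g i * e i = g i := fun i => by simp only [g, mul_assoc, he]
  have hκg : ∀ i c, Commute (κ c) (g i) := fun i c =>
    ((hκι c _).mul_right (hκu c _)).mul_right (hκι c _)
  let η : J → K[X] →ₙ+* R := fun i => cornerEval κ (g i) (e i) (hκg i) (fun c => hκι c _)
    ((heg i).trans (hge i).symm) (he i)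
  have hηC : ∀ i c, η i (C c) = e i * κ c := fun i c => by
    change e i * eval₂ κ (g i) (C c) = _
    rw [eval₂_C]
  have hη1 : ∀ i, η i 1 = e i := fun i => by
    rw [← C_1, hηC, map_one, mul_one]
  have hηX : ∀ i, η i Polynomial.X = g i := fun i => by
    change e i * eval₂ κ (g i) Polynomial.X = _
    rw [eval₂_X, heg]
  -- matrix units for the levels: `s i a` moves the base of a tower up to level `a`, `r i a` back
  let s : ∀ i, Fin (h i + 1) → R := fun i a => u (a : ℕ) * e i
  let r : ∀ i, Fin (h i + 1) → R := fun i a => e i * u (-((a : ℕ) : ℤ))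
  have hrs : ∀ i j (a : Fin (h i + 1)) (b : Fin (h j + 1)), r i a * s j b =
      ι (χ i * (α ^ (-((a : ℕ) : ℤ) + ((b : ℕ) : ℤ))) (χ j)) * u (-((a : ℕ) : ℤ) + (b : ℕ)) :=
    fun i j a b => by
      simp only [r, s]
      rw [mul_assoc, ← mul_assoc (u _), hu]
      simp only [e]
      rw [huι, ← mul_assoc, ← map_mul]
  have hrs0 : ∀ i j (a : Fin (h i + 1)) (b : Fin (h j + 1)), ¬ (i = j ∧ (a : ℕ) = b) →
      r i a * s j b = 0 := fun i j a b hne => by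
    rw [hrs]
    have : χ i * (α ^ (-((a : ℕ) : ℤ) + ((b : ℕ) : ℤ))) (χ j) = 0 := by
      ext x
      rw [LocallyConstant.mul_apply, hα, hχ, hχ]
      by_cases hx : x ∈ V i
      · by_cases hx' : (T ^ (-(-((a : ℕ) : ℤ) + ((b : ℕ) : ℤ)))) x ∈ V j
        · refine absurd (hV.unique_level i j a b ((T ^ ((a : ℕ) : ℤ)) x) (Nat.le_of_lt_succ a.2)
            (Nat.le_of_lt_succ b.2) ?_ ?_) hne
          · rwa [← Homeomorph.zpow_add_apply, neg_add_cancel, Homeomorph.zpow_zero_apply]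
          · rw [← Homeomorph.zpow_add_apply]
            convert hx' using 3
            ring
        · rw [if_neg hx', mul_zero]
          rfl
      · rw [if_neg hx, zero_mul]
        rfl
    rw [this, map_zero, zero_mul]
  have hsr : ∀ i (a : Fin (h i + 1)), s i a * r i a = ι ((α ^ ((a : ℕ) : ℤ)) (χ i)) := fun i a => by
    simp only [r, s]
    rw [mul_assoc, ← mul_assoc (e i), he]
    simp only [e]
    rw [← mul_assoc, huι, mul_assoc, hu, add_neg_cancel, hu0, mul_one]
  have hpart : ∑ i, ∑ a, s i a * r i a = 1 := by
    simp only [hsr]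
    simp only [← map_sum]
    rw [← map_one ι]
    congr 1
    ext x
    obtain ⟨i, a, ha, hx⟩ := hV.exists_level x
    have hterm : ∀ (j : J) (b : Fin (h j + 1)), (α ^ ((b : ℕ) : ℤ)) (χ j) x =
        if (T ^ (-((b : ℕ) : ℤ))) x ∈ V j then 1 else 0 := fun j b => by rw [hα, hχ]
    have hsumx : (∑ i, ∑ a : Fin (h i + 1), (α ^ ((a : ℕ) : ℤ)) (χ i)) x =
        ∑ i, ∑ a : Fin (h i + 1), (α ^ ((a : ℕ) : ℤ)) (χ i) x := by
      have := fun f : J → LocallyConstant X K => map_sum (LocallyConstant.evalRingHom x) f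
        Finset.univ
      refine (this _).trans (Finset.sum_congr rfl fun j _ => ?_)
      exact map_sum (LocallyConstant.evalRingHom x) _ _
    rw [hsumx]
    simp only [hterm]
    rw [Finset.sum_eq_single i, Finset.sum_eq_single ⟨a, Nat.lt_succ_of_le ha⟩]
    · rw [if_pos hx]
      rfl
    · intro b _ hb
      refine if_neg fun hx' => hb (Fin.ext ?_)
      exact (hV.unique_level i i a b x ha (Nat.le_of_lt_succ b.2) hx hx').2.symm
    · simp
    · intro j _ hj
      refine Finset.sum_eq_zero fun b _ => if_neg fun hx' => hj ?_
      exact (hV.unique_level i j a b x ha (Nat.le_of_lt_succ b.2) hx hx').1.symm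
    · simp
  have hsys : IsTowerSystem η s r :=
    { mul_self := fun i a => by
        rw [hη1]
        simp only [r, s]
        rw [mul_assoc, ← mul_assoc (u _), hu, neg_add_cancel, hu0, one_mul, he]
      mul_of_ne := fun i a b hab => hrs0 i i a b fun hh => hab (Fin.ext hh.2)
      mul_of_ne' := fun i j a b hij => hrs0 i j a b fun hh => hij hh.1
      corner_mul := fun i a => by
        rw [hη1]
        simp only [r]
        rw [← mul_assoc, he]
      sum_eq_one := hpart }
  let ρ : LocallyConstant X K →+* ∀ i, Matrix (Fin (h i + 1)) (Fin (h i + 1)) K[X] :=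
    RingHom.pi fun i => (Matrix.diagonalRingHom (Fin (h i + 1)) K[X]).comp
      (RingHom.pi fun a => (C : K →+* K[X]).comp
        (LocallyConstant.evalRingHom ((T ^ ((a : ℕ) : ℤ)) (x₀ i))))
  have hρ : ∀ b i, ρ b i = Matrix.diagonal fun a : Fin (h i + 1) =>
      C (b ((T ^ ((a : ℕ) : ℤ)) (x₀ i))) := fun b i => rfl
  refine ⟨_, inferInstance, hsys.hom, ρ, fun i => towerShift (h i),
    IsLocallyRepresentable.pi fun i => isLocallyRepresentable_polynomial.matrix (h i), ?_, ?_⟩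
  · intro b hb
    rw [hsys.hom_apply, ← mul_one (ι b), ← hpart, Finset.mul_sum]
    refine Finset.sum_congr rfl fun i _ => ?_
    rw [Finset.mul_sum]
    refine Finset.sum_congr rfl fun a _ => ?_
    rw [Finset.sum_eq_single a]
    · rw [hρ, Matrix.diagonal_apply_eq, hηC, ← mul_assoc (ι b)]
      congr 1
      simp only [s]
      have h2 : ι b * u (a : ℕ) = u (a : ℕ) * ι ((α ^ (-((a : ℕ) : ℤ))) b) := by
        rw [huι, ← RingAut.mul_apply, ← zpow_add, add_neg_cancel, zpow_zero, RingAut.one_apply]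
      rw [← mul_assoc (ι b), h2, mul_assoc (u _), ← mul_assoc (e i), he, mul_assoc]
      congr 1
      simp only [e, κ]
      change ι _ * ι _ = _
      rw [← map_mul, ← map_mul, mul_comm]
      congr 1
      ext x
      rw [LocallyConstant.mul_apply, LocallyConstant.mul_apply, hα, hχ]
      split_ifs with hx
      · congr 1
        have h3 := congrFun (hVc i a (Nat.le_of_lt_succ a.2) (x₀ i) (hx₀ i) x hx) ⟨b, hb⟩
        rw [neg_neg]
        exact h3
      · simp
    · intro c _ hc
      rw [hρ, Matrix.diagonal_apply_ne _ hc.symm, map_zero, mul_zero, zero_mul]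
    · simp
  · -- `t` and its approximation differ only on the exits from the towers
    have hdiff : (t : R) - hsys.hom (fun i => towerShift (h i)) =
        ∑ i, (u ((h i : ℤ) + 1) * e i - g i) * r i (Fin.last (h i)) := by
      have ht1 : (t : R) = u 1 := by simp [u]
      rw [hsys.hom_apply, ← mul_one (t : R), ← hpart, Finset.mul_sum, ← Finset.sum_sub_distrib]
      refine Finset.sum_congr rfl fun i _ => ?_
      rw [Finset.mul_sum, Finset.sum_comm, ← Finset.sum_sub_distrib, Fin.sum_univ_castSucc]
      have hcast : ∀ b : Fin (h i), (t : R) * (s i b.castSucc * r i b.castSucc) -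
          ∑ a, s i a * η i (towerShift (h i) a b.castSucc) * r i b.castSucc = 0 := fun b => by
        rw [Finset.sum_eq_single b.succ]
        · have h2 : (towerShift (h i) b.succ b.castSucc : K[X]) = 1 := by
            simp [towerShift]
          rw [h2, hη1, ← mul_assoc, sub_eq_zero]
          congr 1
          simp only [s]
          rw [mul_assoc, he, ← mul_assoc, ht1, hu]
          congr 2
          rw [Fin.val_succ, Fin.val_castSucc]
          push_cast
          ring
        · intro a _ ha
          have h2 : (towerShift (h i) a b.castSucc : K[X]) = 0 := by
            simp [towerShift, ha]
          rw [h2, map_zero, mul_zero, zero_mul]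
        · simp
      rw [Finset.sum_eq_zero fun b _ => hcast b, zero_add, Finset.sum_eq_single 0]
      · have h2 : (towerShift (h i) 0 (Fin.last (h i)) : K[X]) = Polynomial.X := by
          simp [towerShift]
        rw [h2, hηX, sub_mul, ← mul_assoc]
        congr 2
        · simp only [s]
          rw [← mul_assoc, ht1, hu, Fin.val_last, add_comm]
        · simp only [s]
          rw [Fin.val_zero, Nat.cast_zero, hu0, one_mul, heg]
      · intro a _ ha
        have h2 : (towerShift (h i) a (Fin.last (h i)) : K[X]) = 0 := by
          simp [towerShift, ha]
        rw [h2, map_zero, mul_zero, zero_mul]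
      · simp
    rw [hdiff]
    refine (hrk.elt_sum_le _ _).trans ((Finset.sum_le_sum fun i _ => ?_).trans hsum)
    refine (hrk.elt_mul_le_left _ _).trans ?_
    have hcl := ((hV.isClopen i).preimage_zpow T (-((h i : ℤ) + 1))).diff (hV.isClopen i)
    rw [hμrk _ hcl]
    have h2 : u ((h i : ℤ) + 1) * e i - g i =
        ι (LocallyConstant.charFn K hcl) * u ((h i : ℤ) + 1) := by
      simp only [g]
      rw [mul_assoc]
      simp only [e]
      rw [huι, ← mul_assoc, ← map_mul, ← sub_mul, ← map_sub]
      congr 2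
      ext x
      rw [LocallyConstant.sub_apply, LocallyConstant.mul_apply, hα, hχ, hχ,
        LocallyConstant.coe_charFn]
      by_cases hx : x ∈ V i <;> by_cases hx' : (T ^ (-((h i : ℤ) + 1))) x ∈ V i <;>
        simp [hx, Set.indicator_apply]
    rw [h2]
    exact hrk.elt_mul_le_left _ _

end approximation

end towerApproximation

/-! ### The algebraic crossed product -/

section crossedProduct

namespace CrossedProduct

variable {A : Type u} [Ring A] (α : RingAut A)

/-- The coefficient ring inside the crossed product. -/
noncomputable def ofBase : A →+* CrossedProduct α :=
  letI := zpowAction α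
  (SkewMonoidAlgebra.singleOneRingHom : A →+* SkewMonoidAlgebra A (Multiplicative ℤ))

/-- The powers of the generator `t` inside the crossed product. -/
noncomputable def ofPow : Multiplicative ℤ →* (CrossedProduct α)ˣ :=
  letI := zpowAction α
  (SkewMonoidAlgebra.of A (Multiplicative ℤ)).toHomUnits

/-- The invertible generator `t` of the crossed product. -/
noncomputable def gen : (CrossedProduct α)ˣ :=
  ofPow α (Multiplicative.ofAdd 1)

theorem ofPow_eq_gen_zpow (n : Multiplicative ℤ) : ofPow α n = gen α ^ n.toAdd := by
  rw [gen, ← map_zpow, ← ofAdd_zsmul, smul_eq_mul, mul_one, ofAdd_toAdd]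

theorem gen_mul_ofBase (b : A) :
    (gen α : CrossedProduct α) * ofBase α b = ofBase α (α b) * gen α := by
  let := zpowAction α
  change (SkewMonoidAlgebra.single (Multiplicative.ofAdd (1 : ℤ)) (1 : A) *
    SkewMonoidAlgebra.single (1 : Multiplicative ℤ) b : SkewMonoidAlgebra A (Multiplicative ℤ)) =
    (SkewMonoidAlgebra.single (1 : Multiplicative ℤ) (α b) *
    SkewMonoidAlgebra.single (Multiplicative.ofAdd (1 : ℤ)) (1 : A) :
      SkewMonoidAlgebra A (Multiplicative ℤ))
  rw [SkewMonoidAlgebra.single_mul_single, SkewMonoidAlgebra.single_mul_single, one_smul, mul_one,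
    one_mul, one_mul, mul_one]
  rfl

@[elab_as_elim]
theorem induction {p : CrossedProduct α → Prop} (x : CrossedProduct α)
    (monomial : ∀ (b : A) (n : ℤ), p (ofBase α b * ((gen α ^ n : (CrossedProduct α)ˣ) :)))
    (add : ∀ x y, p x → p y → p (x + y)) : p x := by
  let := zpowAction α
  refine SkewMonoidAlgebra.induction_on' (k := A) (G := Multiplicative ℤ) x (fun n b => ?_) add
  have := monomial b n.toAdd
  rw [← ofPow_eq_gen_zpow] at this
  have h2 : (SkewMonoidAlgebra.single n b : SkewMonoidAlgebra A (Multiplicative ℤ)) =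
      (SkewMonoidAlgebra.single (1 : Multiplicative ℤ) b *
    SkewMonoidAlgebra.single n (1 : A) : SkewMonoidAlgebra A (Multiplicative ℤ)) := by
    rw [SkewMonoidAlgebra.single_mul_single, one_smul, one_mul, mul_one]
  rw [h2]
  exact this

variable {α} {S : Type w} [Ring S]

/-- The universal property of the crossed product. -/
noncomputable def lift (f : A →+* S) (u : Sˣ) (h : ∀ b, (u : S) * f b = f (α b) * u) :
    CrossedProduct α →+* S :=
  letI := zpowAction α
  (SkewMonoidAlgebra.liftNCRingHom f ((Units.coeHom S).comp (zpowersHom Sˣ u))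
    (fun {b n} => (Units.zpow_mul_of_conj f u h n.toAdd b).symm) :
      SkewMonoidAlgebra A (Multiplicative ℤ) →+* S)

theorem lift_ofBase (f : A →+* S) (u : Sˣ) (h : ∀ b, (u : S) * f b = f (α b) * u) (b : A) :
    lift f u h (ofBase α b) = f b := by
  let := zpowAction α
  refine (SkewMonoidAlgebra.liftNC_single (k := A) (G := Multiplicative ℤ) (f : A →+ S)
    ((Units.coeHom S).comp (zpowersHom Sˣ u)) 1 b).trans ?_
  rw [map_one, mul_one]
  rfl

theorem lift_gen (f : A →+* S) (u : Sˣ) (h : ∀ b, (u : S) * f b = f (α b) * u) :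
    lift f u h (gen α) = u := by
  let := zpowAction α
  refine (SkewMonoidAlgebra.liftNC_single (k := A) (G := Multiplicative ℤ) (f : A →+ S)
    ((Units.coeHom S).comp (zpowersHom Sˣ u)) (Multiplicative.ofAdd 1) 1).trans ?_
  rw [AddMonoidHom.coe_coe, map_one, one_mul, MonoidHom.comp_apply, zpowersHom_apply, toAdd_ofAdd,
    zpow_one]
  rfl

end CrossedProduct

end crossedProduct

/-! ### Noncommutative polynomials -/

section words

variable {B : Type a}

/-- Evaluation of a noncommutative polynomial in letters `some b`, for `b : B`, and `none`. -/
noncomputable def wordEval {R : Type w} [Ring R] (f : B → R) (t : R) :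
    FreeAlgebra ℤ (Option B) →ₐ[ℤ] R :=
  FreeAlgebra.lift ℤ fun o => o.elim t f

@[simp]
theorem wordEval_some {R : Type w} [Ring R] (f : B → R) (t : R) (b : B) :
    wordEval f t (FreeAlgebra.ι ℤ (some b)) = f b :=
  FreeAlgebra.lift_ι_apply _ _

@[simp]
theorem wordEval_none {R : Type w} [Ring R] (f : B → R) (t : R) :
    wordEval f t (FreeAlgebra.ι ℤ none) = t :=
  FreeAlgebra.lift_ι_apply _ _

theorem ringHom_wordEval {R : Type w} [Ring R] {S : Type b} [Ring S] (ψ : S →+* R) (g : B → S)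
    (τ : S) (x : FreeAlgebra ℤ (Option B)) :
    ψ (wordEval g τ x) = wordEval (fun b => ψ (g b)) (ψ τ) x := by
  induction x using FreeAlgebra.induction with
  | grade0 r => simp
  | grade1 o => cases o <;> simp
  | mul x y hx hy => rw [map_mul, map_mul, map_mul, hx, hy]
  | add x y hx hy => rw [map_add, map_add, map_add, hx, hy]

/-- In the pseudometric `rk (x - y)`, the value of a noncommutative polynomial is a Lipschitz
function of each letter. -/
theorem IsWeakSylvester.exists_elt_wordEval_sub_le {R : Type w} [Ring R] {rk : MatrixFunction R}
    (h : IsWeakSylvester rk) (f : B → R) (t : R) (x : FreeAlgebra ℤ (Option B)) :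
    ∃ (c : ℝ) (F : Finset B), 0 ≤ c ∧ ∀ (g : B → R) (t' : R), (∀ b ∈ F, g b = f b) →
      rk.elt (wordEval f t x - wordEval g t' x) ≤ c * rk.elt (t - t') := by
  classical
  induction x using FreeAlgebra.induction with
  | grade0 r =>
    refine ⟨0, ∅, le_rfl, fun g t' _ => ?_⟩
    rw [AlgHom.commutes, AlgHom.commutes, sub_self, h.elt_zero, zero_mul]
  | grade1 o =>
    cases o with
    | none =>
      refine ⟨1, ∅, zero_le_one, fun g t' _ => ?_⟩
      rw [wordEval_none, wordEval_none, one_mul]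
    | some b =>
      refine ⟨0, {b}, le_rfl, fun g t' hg => ?_⟩
      rw [wordEval_some, wordEval_some, hg b (Finset.mem_singleton_self b), sub_self, h.elt_zero,
        zero_mul]
  | mul x y hx hy =>
    obtain ⟨c, F, hc, hx⟩ := hx
    obtain ⟨d, G, hd, hy⟩ := hy
    refine ⟨c + d, F ∪ G, add_nonneg hc hd, fun g t' hg => ?_⟩
    have h1 := hx g t' fun b hb => hg b (Finset.mem_union_left _ hb)
    have h2 := hy g t' fun b hb => hg b (Finset.mem_union_right _ hb)
    have : wordEval f t (x * y) - wordEval g t' (x * y) =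
        (wordEval f t x - wordEval g t' x) * wordEval f t y +
          wordEval g t' x * (wordEval f t y - wordEval g t' y) := by
      rw [map_mul, map_mul]
      noncomm_ring
    rw [this, add_mul]
    exact (h.elt_add_le _ _).trans (add_le_add ((h.elt_mul_le_left _ _).trans h1)
      ((h.elt_mul_le_right _ _).trans h2))
  | add x y hx hy =>
    obtain ⟨c, F, hc, hx⟩ := hx
    obtain ⟨d, G, hd, hy⟩ := hy
    refine ⟨c + d, F ∪ G, add_nonneg hc hd, fun g t' hg => ?_⟩
    have h1 := hx g t' fun b hb => hg b (Finset.mem_union_left _ hb)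
    have h2 := hy g t' fun b hb => hg b (Finset.mem_union_right _ hb)
    rw [map_add, map_add, add_sub_add_comm, add_mul]
    exact (h.elt_add_le _ _).trans (add_le_add h1 h2)

end words

section wordRank

variable {X : Type u} [TopologicalSpace X] [CompactSpace X] [T2Space X]
  [TotallyDisconnectedSpace X] {K : Type v} [Field K] {R : Type w} [Ring R]
  {T : X ≃ₜ X} {ι : LocallyConstant X K →+* R} {t : Rˣ}

/-- Pulled back to noncommutative polynomials, a rank function is regular. -/
theorem Implements.exists_regularRankRing_wordEval (H : Implements T ι t) {rk : MatrixFunction R}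
    (hrk : IsWeakSylvester rk) (h1 : rk.elt 1 = 1) :
    ∃ (S : Type max u v) (_ : Ring S) (N : S → ℝ) (rkS : MatrixFunction S)
      (Φ : FreeAlgebra ℤ (Option (LocallyConstant X K)) →+* S),
      IsVonNeumannRegular S ∧ IsRankFunction N ∧ IsSylvesterRank rkS ∧
      (∀ x : S, rkS 1 1 (Matrix.of fun _ _ => x) = N x) ∧
      ∀ (m n : ℕ) (A : Matrix (Fin m) (Fin n) (FreeAlgebra ℤ (Option (LocallyConstant X K)))),
        rk m n (A.map (wordEval ι t)) = rkS m n (A.map Φ) := by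
  classical
  refine exists_regularRankRing_of_approx.{max u v, v}
    (fun m n (A : Matrix (Fin m) (Fin n) (FreeAlgebra ℤ (Option (LocallyConstant X K)))) =>
      rk m n (A.map (wordEval ι t))) ?_ fun F ε hε => ?_
  · rw [← h1]
    change rk 1 1 _ = rk 1 1 _
    congr 1
    ext
    exact map_one (wordEval (⇑ι) (t : R))
  choose c G hc hG using hrk.exists_elt_wordEval_sub_le (⇑ι) (t : R)
  let C : (Σ m n : ℕ, Matrix (Fin m) (Fin n) (FreeAlgebra ℤ (Option (LocallyConstant X K)))) → ℝ :=
    fun M => ∑ i, ∑ j, c (M.2.2 i j)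
  have hC : ∀ M, 0 ≤ C M := fun M =>
    Finset.sum_nonneg fun i _ => Finset.sum_nonneg fun j _ => hc _
  have hC1 : 0 < 1 + ∑ M ∈ F, C M :=
    add_pos_of_pos_of_nonneg one_pos (Finset.sum_nonneg fun M _ => hC M)
  obtain ⟨S₀, _, ψ, ρ, τ, hS₀, hρ, hτ⟩ := H.exists_approx hrk h1
    (F.biUnion fun M => Finset.univ.biUnion fun i => Finset.univ.biUnion fun j => G (M.2.2 i j))
    (div_pos hε hC1)
  let ev : (Σ m n : ℕ, Matrix (Fin m) (Fin n) (FreeAlgebra ℤ (Option (LocallyConstant X K)))) →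
      Σ m n : ℕ, Matrix (Fin m) (Fin n) S₀ := fun M => ⟨M.1, M.2.1, M.2.2.map (wordEval ρ τ)⟩
  obtain ⟨r, hr, hrF⟩ := hS₀ _ (hrk.comap ψ) (F.image ev)
  obtain ⟨S, _, rkS, φ, hS, hrkS, hφ⟩ := hr.exists_regular
  refine ⟨S, inferInstance, rkS, φ.comp (wordEval ρ τ : _ →+* S₀), hS, hrkS, fun M hM => ?_⟩
  have h2 := hrF _ (Finset.mem_image_of_mem _ hM)
  have h3 := hφ M.1 M.2.1 (M.2.2.map (wordEval ρ τ))
  have h4 : rkS M.1 M.2.1 (M.2.2.map (φ.comp (wordEval ρ τ : _ →+* S₀))) =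
      rk M.1 M.2.1 ((M.2.2.map (wordEval ρ τ)).map ψ) :=
    (h2.trans h3).symm
  rw [h4, ← hrk.onFintype_fin, ← hrk.onFintype_fin]
  refine (hrk.abs_onFintype_sub_le _ _).trans ((hrk.onFintype_le_sum_elt _).trans ?_)
  have h5 : ∀ i j, rk.elt ((M.2.2.map (wordEval ι t) - (M.2.2.map (wordEval ρ τ)).map ψ) i j) ≤
      c (M.2.2 i j) * (ε / (1 + ∑ M ∈ F, C M)) := fun i j => by
    rw [Matrix.sub_apply, Matrix.map_apply, Matrix.map_apply, Matrix.map_apply, ringHom_wordEval]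
    refine (hG _ _ _ fun b hb => hρ b ?_).trans (mul_le_mul_of_nonneg_left hτ (hc _))
    simp only [Finset.mem_biUnion, Finset.mem_univ, true_and]
    exact ⟨M, hM, i, j, hb⟩
  calc _ ≤ ∑ i, ∑ j, c (M.2.2 i j) * (ε / (1 + ∑ M ∈ F, C M)) :=
        Finset.sum_le_sum fun i _ => Finset.sum_le_sum fun j _ => h5 i j
    _ = C M * (ε / (1 + ∑ M ∈ F, C M)) := by simp only [C, Finset.sum_mul]
    _ ≤ (1 + ∑ M ∈ F, C M) * (ε / (1 + ∑ M ∈ F, C M)) := by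
        refine mul_le_mul_of_nonneg_right ?_ (div_pos hε hC1).le
        linarith [Finset.single_le_sum (fun M _ => hC M) hM]
    _ = ε := mul_div_cancel₀ _ hC1.ne'

end wordRank

/-! ### Rank functions on the crossed product -/

section regularity

/-- In a regular ring, an element of full rank is invertible. -/
theorem IsVonNeumannRegular.isUnit_of_rank_eq_one {S : Type u} [Ring S]
    (hS : IsVonNeumannRegular S) {N : S → ℝ} (hN : IsRankFunction N) {x : S} (hx : N x = 1) :
    IsUnit x := by
  obtain ⟨y, hy⟩ := hS x
  have key : ∀ e : S, e * e = e → 1 ≤ N e → e = 1 := fun e he h => by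
    have h2 := hN.add_of_orthogonal e (1 - e) he (IsIdempotentElem.one_sub he)
      (by rw [mul_sub, he, mul_one, sub_self]) (by rw [sub_mul, he, one_mul, sub_self])
    rw [add_sub_cancel, hN.map_one] at h2
    have h3 := (hN.mem_Icc (1 - e)).1
    have h4 : N (1 - e) = 0 := by linarith
    exact (sub_eq_zero.mp ((hN.eq_zero_iff _).mp h4)).symm
  have h1 : x * y = 1 := key _ (by rw [← mul_assoc, ← hy])
    (by rw [← hx]; nth_rw 1 [hy]; exact hN.mul_le_left _ _)
  have h2 : y * x = 1 := key _ (by rw [mul_assoc, ← mul_assoc x, ← hy])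
    (by rw [← hx]; nth_rw 1 [hy]; rw [mul_assoc]; exact hN.mul_le_right _ _)
  exact ⟨⟨x, y, h1, h2⟩, rfl⟩

theorem IsWeakSylvester.units_smul {R : Type u} [Ring R] {rk : MatrixFunction R}
    (h : IsWeakSylvester rk) (v : Rˣ) {m n : ℕ} (M : Matrix (Fin m) (Fin n) R) :
    rk m n ((v : R) • M) = rk m n M := by
  have key : ∀ (v : Rˣ) (M : Matrix (Fin m) (Fin n) R), rk m n ((v : R) • M) ≤ rk m n M :=
    fun v M => by
      rw [Matrix.smul_eq_diagonal_mul]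
      exact h.mul_le_right _ _ _ _ _
  refine le_antisymm (key v M) ?_
  have := key v⁻¹ ((v : R) • M)
  rwa [smul_smul, Units.inv_mul, one_smul] at this

end regularity

section main

variable {X : Type u} [TopologicalSpace X] {K : Type v} [Field K] {T : X ≃ₜ X}

open CrossedProduct

/-- Multiplication by a high power of `t` turns an element of the crossed product into the value of
a noncommutative polynomial. -/
theorem CrossedProduct.exists_gen_pow_mul_eq_wordEval (x : HomeoCrossedProduct K T) :
    ∃ L : ℕ, ∀ k ≥ L, ∃ y, ((gen (homeoAut K T) ^ (k : ℤ) : (HomeoCrossedProduct K T)ˣ) :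
      HomeoCrossedProduct K T) * x =
        wordEval (ofBase (homeoAut K T)) (gen (homeoAut K T) : HomeoCrossedProduct K T) y := by
  induction x using CrossedProduct.induction with
  | monomial b n =>
    refine ⟨n.natAbs, fun k hk => ⟨FreeAlgebra.ι ℤ (some ((homeoAut K T ^ (k : ℤ)) b)) *
      FreeAlgebra.ι ℤ none ^ ((k : ℤ) + n).toNat, ?_⟩⟩
    have hkn : 0 ≤ (k : ℤ) + n := by omega
    rw [map_mul, map_pow, wordEval_some, wordEval_none, ← mul_assoc,
      Units.zpow_mul_of_conj _ _ (gen_mul_ofBase _), mul_assoc, ← Units.val_mul, ← zpow_add,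
      ← Units.val_pow_eq_pow_val, ← zpow_natCast, Int.toNat_of_nonneg hkn]
  | add x y hx hy =>
    obtain ⟨L, hL⟩ := hx
    obtain ⟨L', hL'⟩ := hy
    refine ⟨max L L', fun k hk => ?_⟩
    obtain ⟨z, hz⟩ := hL k (le_of_max_le_left hk)
    obtain ⟨z', hz'⟩ := hL' k (le_of_max_le_right hk)
    exact ⟨z + z', by rw [mul_add, hz, hz', map_add]⟩

/-- A Sylvester rank function on the crossed product is induced by a homomorphism to a regular rank
ring. -/
theorem exists_regularRankRing_of_isSylvesterRank [CompactSpace X] [T2Space X]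
    [TotallyDisconnectedSpace X] {rk : MatrixFunction (HomeoCrossedProduct K T)}
    (hrk : IsSylvesterRank rk) :
    ∃ (S : Type max u v) (_ : Ring S) (N : S → ℝ) (rkS : MatrixFunction S)
      (φ : HomeoCrossedProduct K T →+* S), IsVonNeumannRegular S ∧ IsRankFunction N ∧
      IsSylvesterRank rkS ∧ (∀ x : S, rkS 1 1 (Matrix.of fun _ _ => x) = N x) ∧
      ∀ (m n : ℕ) (A : Matrix (Fin m) (Fin n) (HomeoCrossedProduct K T)),
        rk m n A = rkS m n (A.map φ) := by
  classical
  have hw := hrk.isWeakSylvester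
  have h1 : rk.elt 1 = 1 := by
    rw [← hrk.map_one]
    change rk 1 1 _ = rk 1 1 _
    congr 1
    ext i j
    rw [Subsingleton.elim i j, Matrix.one_apply_eq, Matrix.of_apply]
  let ι := ofBase (homeoAut K T)
  let t : (HomeoCrossedProduct K T)ˣ := gen (homeoAut K T)
  have H : Implements T ι t := gen_mul_ofBase _
  obtain ⟨S, _, N, rkS, Φ, hS, hN, hrkS, hNrk, hΦ⟩ := H.exists_regularRankRing_wordEval hw h1
  let ev := wordEval (ι : _ → HomeoCrossedProduct K T) (t : HomeoCrossedProduct K T)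
  have hNΦ : ∀ x, N (Φ x) = rk.elt (ev x) := fun x => by
    rw [← hNrk]
    exact (hΦ 1 1 (Matrix.of fun _ _ => x)).symm
  -- `Φ` factors through evaluation, since `N` only vanishes at zero
  have hfac : ∀ x y, ev x = ev y → Φ x = Φ y := fun x y hxy => by
    rw [← sub_eq_zero, ← map_sub, ← hN.eq_zero_iff, hNΦ, map_sub, hxy, sub_self, hw.elt_zero]
  have hs : ∀ b, ev (FreeAlgebra.ι ℤ (some b)) = ι b := fun b => wordEval_some _ _ b
  have hn : ev (FreeAlgebra.ι ℤ none) = t := wordEval_none _ _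
  let ρ : LocallyConstant X K →+* S :=
    { toFun := fun b => Φ (FreeAlgebra.ι ℤ (some b))
      map_zero' := by
        rw [← map_zero Φ]
        exact hfac _ _ (by rw [hs, map_zero, map_zero])
      map_one' := by
        rw [← map_one Φ]
        exact hfac _ _ (by rw [hs, map_one, map_one])
      map_add' := fun b c => by
        rw [← map_add Φ]
        exact hfac _ _ (by rw [hs, map_add, map_add, hs, hs])
      map_mul' := fun b c => by
        rw [← map_mul Φ]
        exact hfac _ _ (by rw [hs, map_mul, map_mul, hs, hs]) }
  obtain ⟨u, hu⟩ : IsUnit (Φ (FreeAlgebra.ι ℤ none)) := by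
    refine hS.isUnit_of_rank_eq_one hN ?_
    rw [hNΦ, hn]
    refine le_antisymm ((hw.elt_le_one _).trans h1.le) ?_
    rw [← h1, ← Units.mul_inv t]
    exact hw.elt_mul_le_left _ _
  have hρu : ∀ b, (u : S) * ρ b = ρ (homeoAut K T b) * u := fun b => by
    rw [hu]
    change Φ _ * Φ _ = Φ _ * Φ _
    rw [← map_mul, ← map_mul]
    exact hfac _ _ (by rw [map_mul, map_mul, hs, hs, hn, H])
  let φ : HomeoCrossedProduct K T →+* S := lift ρ u hρu
  have hφev : ∀ x, φ (ev x) = Φ x := fun x => by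
    induction x using FreeAlgebra.induction with
    | grade0 r => simp
    | grade1 o =>
      cases o with
      | none => rw [hn, ← hu]; exact lift_gen ρ u hρu
      | some b => rw [hs]; exact lift_ofBase ρ u hρu b
    | mul x y hx hy => rw [map_mul, map_mul, map_mul, hx, hy]
    | add x y hx hy => rw [map_add, map_add, map_add, hx, hy]
  refine ⟨S, inferInstance, N, rkS, φ, hS, hN, hrkS, hNrk, fun m n A => ?_⟩
  choose L hL using fun x : HomeoCrossedProduct K T => exists_gen_pow_mul_eq_wordEval x
  let k : ℕ := Finset.univ.sup fun p : Fin m × Fin n => L (A p.1 p.2)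
  have hk : ∀ i j, ∃ y, ((t ^ (k : ℤ) : (HomeoCrossedProduct K T)ˣ) :
      HomeoCrossedProduct K T) * A i j = ev y := fun i j =>
    hL (A i j) k (Finset.le_sup (f := fun p : Fin m × Fin n => L (A p.1 p.2))
      (Finset.mem_univ (i, j)))
  choose B hB using hk
  have hA : (((t ^ (k : ℤ) : (HomeoCrossedProduct K T)ˣ) : HomeoCrossedProduct K T) • A) =
      (Matrix.of B).map ev := by
    ext i j : 2
    exact hB i j
  rw [← hw.units_smul (t ^ (k : ℤ)), hA]
  refine (hΦ m n (Matrix.of B)).trans ?_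
  rw [← hrkS.isWeakSylvester.units_smul (Units.map (φ : _ →* S) (t ^ (k : ℤ))) (A.map φ)]
  refine congrArg (rkS m n) (Matrix.ext fun i j => ?_)
  change Φ (B i j) = φ ((t ^ (k : ℤ) : (HomeoCrossedProduct K T)ˣ) : HomeoCrossedProduct K T) *
    φ (A i j)
  rw [← map_mul, hB, hφev]

end main

theorem theorem5p5 {X : Type u} [MetricSpace X] [CompactSpace X] [TotallyDisconnectedSpace X]
    {K : Type v} [Field K] (T : X ≃ₜ X) :
    SylvesterSpace (HomeoCrossedProduct K T) = RegularSylvesterSpace (HomeoCrossedProduct K T) :=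
  Set.Subset.antisymm (fun _ h => ⟨h, exists_regularRankRing_of_isSylvesterRank h⟩) fun _ h => h.1
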